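/- **Setting.** Computability is type-two computability. Names are infinite sequences of natural numbers, and a map between named (represented) types is computable if some machine turns every name of an argument into a name of the value. The type $\mathcal O(X)$ of open sets is the function type $X\to\mathbb S$ into the Sierpiński space, a closed set is named by a name of its complement, and an element of $[0,\infty]_<$ (the lower topology) is named by an increasing sequence of non-negative rationals with that supremum; function types carry the exponential representation. A *computable metric space* $(X,d)$ is a metric space with an admissible quotient representation such that $d:X\times X\to\mathbb R^+$ is computable and $(x,A)\mapsto d(x,A)=\inf_{y\in A}d(x,y)$ is computable from points and closed sets into $[0,\infty]_<$ (with $d(x,\emptyset)=\infty$). Let $\Omega=\{0,1\}^\omega$ be Cantor space with the fair-coin measure $P$. A *continuous random variable* in $X$ is a continuous map $\Omega\to X$. The Fan metric on continuous random variables is $$d(Y,Z)=\sup\{\varepsilon\in\mathbb Q^+ \mid P(\{\omega \mid d(Y(\omega),Z(\omega))>\varepsilon\})>\varepsilon\}\qquad(\sup\emptyset=0).$$ A *measurable random variable* is an element of the completion under this metric. It is named by a sequence of names of continuous random variables $X_n$ that converges to it and satisfies $d(X_m,X_n)<2^{-\min(m,n)}$ for all $m,n$. For $U$ open let $I_\varepsilon(U)=\{x\in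 X\mid d(x,X\setminus U)>\varepsilon\}$. The *distribution* of a measurable random variable $Z$ is $$\Pr(Z\in U)=\sup\{P(Y\in V)-\varepsilon \mid \varepsilon\in\mathbb Q^+,\ Y \text{ a continuous random variable},\ V \text{ open},\ V\subset I_\varepsilon(U),\ d(Y,Z)<\varepsilon\}.$$ **Theorem (Computability of distribution).** Let $(X,d)$ be a computable metric space. 1. For every measurable random variable $Z$ in $X$, the map $\nu:U\mapsto\Pr(Z\in U)$ takes values in $[0,1]$ and is a valuation: it is (Scott-)continuous into $[0,\infty]_<$, $\nu(\emptyset)=0$, and $\nu(U)+\nu(V)=\nu(U\cup V)+\nu(U\cap V)$ for all open $U,V$. 2. The distribution is computable from a name of the random variable: the map sending $Z$ to the valuation $U\mapsto\Pr(Z\in U)$, as an element of $\mathcal O(X)\to[0,\infty]_<$, is computable. 3. If $Y:\Omega\to X$ is a continuous random variable, then $\Pr(Y\in U)=P(\{\omega\in\Omega\mid Y(\omega)\in U\})$ for every open $U$. -/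

import Mathlib

open Filter Topology MeasureTheory
open scoped ENNReal NNReal

noncomputable section

/-! ### Type-two computability on Baire space

Names are infinite sequences of natural numbers.  A partial function on names is given by an
associate in the sense of Kleene: a table `α` which receives an output position `n` and a finite
prefix of the input sequence, and answers either "read more" (value `0`) or "the output symbol at
position `n` is `v`" (value `v + 1`).  The partial functions computed by type-two machines are
exactly the ones (restrictions allowed) with a computable associate, and the continuous partial
functions are exactly the ones with an arbitrary associate. -/

/-- The prefix of length `k` of an infinite sequence. -/
def seqPrefix (p : ℕ → ℕ) (k : ℕ) : List ℕ := (List.range k).map p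

/-- The answer of the table `α` for output position `n` after having read the word `w`. -/
def tableAnswer (α : ℕ → ℕ) (n : ℕ) (w : List ℕ) : ℕ := α (Encodable.encode (n, w))

/-- `Transforms α p q`: on input `p`, the associate `α` is defined and outputs the sequence `q`.
For each output position the first answer other than "read more" counts. -/
def Transforms (α p q : ℕ → ℕ) : Prop :=
  ∀ n, ∃ k, tableAnswer α n (seqPrefix p k) = q n + 1 ∧
    ∀ j < k, tableAnswer α n (seqPrefix p j) = 0

/-- A naming relation: `δ p x` means that `p` is a name of `x`. -/
abbrev Naming (X : Type*) := (ℕ → ℕ) → X → Prop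

/-- Names of pairs. -/
def pairNaming {X Y : Type*} (δ : Naming X) (ε : Naming Y) : Naming (X × Y) := fun p z =>
  δ (fun n => (p n).unpair.1) z.1 ∧ ε (fun n => (p n).unpair.2) z.2

/-- Names of sequences. -/
def seqNaming {X : Type*} (δ : Naming X) : Naming (ℕ → X) := fun p s =>
  ∀ n, δ (fun k => p (Nat.pair n k)) (s n)

/-- The exponential: a name of a function is an associate of one of its realizers. -/
def funNaming {X Y : Type*} (δ : Naming X) (ε : Naming Y) : Naming (X → Y) := fun α f =>
  ∀ p x, δ p x → ∃ q, Transforms α p q ∧ ε q (f x)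

/-- Computability of a function relative to namings: it has a computable realizer. -/
def IsComputableMap {X Y : Type*} (δ : Naming X) (ε : Naming Y) (f : X → Y) : Prop :=
  ∃ α : ℕ → ℕ, Computable α ∧ funNaming δ ε α f

/-- An admissible quotient representation of the topological space `X`: a partial surjection from
sequences to `X`, which is a topological quotient map and through which every partial
continuous function from sequences to `X` factors continuously. -/
structure IsAdmissibleQuotient {X : Type*} [TopologicalSpace X] (δ : Naming X) : Prop where
  functional : ∀ p x y, δ p x → δ p y → x = y
  surjective : ∀ x, ∃ p, δ p x
  quotient : ∀ U : Set X, IsOpen U ↔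
    ∃ W : Set (ℕ → ℕ), IsOpen W ∧ ∀ p x, δ p x → (p ∈ W ↔ x ∈ U)
  admissible : ∀ (D : Set (ℕ → ℕ)) (φ : D → X), Continuous φ →
    ∃ η : D → (ℕ → ℕ), Continuous η ∧ ∀ p, δ (η p) (φ p)

/-! ### Basic types -/

/-- The non-negative rational coded by a natural number. -/
def ratOfCode (n : ℕ) : ℚ≥0 := (n.unpair.1 : ℚ≥0) / ((n.unpair.2 : ℚ≥0) + 1)

/-- Names of points of the half-line `[0, ∞)`: fast converging sequences of rationals. -/
def nnrealNaming : Naming ℝ≥0 := fun p x =>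
  ∀ n, |((ratOfCode (p n) : ℝ≥0) : ℝ) - x| ≤ (2⁻¹ : ℝ) ^ n

/-- Names of points of `[0, ∞]` with the lower topology: increasing sequences of non-negative
rationals with the given supremum. -/
def lowerNaming : Naming ℝ≥0∞ := fun p x =>
  Monotone (fun n => ratOfCode (p n)) ∧ ⨆ n, ((ratOfCode (p n) : ℝ≥0) : ℝ≥0∞) = x

/-- Names of points of the Sierpinski space. -/
def sierpinskiNaming : Naming Prop := fun p s => s ↔ ∃ n, p n ≠ 0

/-- Names of open sets: names of the characteristic function into the Sierpinski space. -/
def openNaming {X : Type*} [TopologicalSpace X] (δ : Naming X) :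
    Naming (TopologicalSpace.Opens X) := fun p U =>
  funNaming δ sierpinskiNaming p (fun x => x ∈ U)

/-- Names of closed sets: names of the open complement. -/
def closedNaming {X : Type*} [TopologicalSpace X] (δ : Naming X) :
    Naming (TopologicalSpace.Closeds X) := fun p A => openNaming δ p A.compl

/-- Computable metric spaces: an admissible quotient representation for which the metric is
computable, and for which the distance of a point to a closed set, with value `∞` for the empty
set, is computable as an element of `[0, ∞]` with the lower topology. -/
structure IsComputableMetricSpace {X : Type*} [MetricSpace X] (δ : Naming X) : Prop where
  representation : IsAdmissibleQuotient δ
  dist_computable :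
    IsComputableMap (pairNaming δ δ) nnrealNaming (fun z : X × X => nndist z.1 z.2)
  infDist_computable :
    IsComputableMap (pairNaming δ (closedNaming δ)) lowerNaming
      (fun z : X × TopologicalSpace.Closeds X => Metric.infEDist z.1 (z.2 : Set X))

/-- Continuous valuations.  A map into `[0, ∞]` with the lower topology is continuous for the Scott
topology on the open sets iff it is Scott-continuous. -/
structure IsValuation {X : Type*} [TopologicalSpace X]
    (ν : TopologicalSpace.Opens X → ℝ≥0∞) : Prop where
  continuous : ScottContinuous ν
  empty : ν ⊥ = 0
  modular : ∀ U V, ν U + ν V = ν (U ⊔ V) + ν (U ⊓ V)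

/-! ### Random variables on Cantor space -/

/-- Cantor space. -/
abbrev Cantor := ℕ → Bool

/-- The standard measure on Cantor space: independent fair coin tosses. -/
def coinMeasure : Measure Cantor :=
  Measure.infinitePi fun _ => (PMF.uniformOfFintype Bool).toMeasure

instance : IsProbabilityMeasure coinMeasure := by
  unfold coinMeasure; infer_instance

/-- A point of Cantor space has itself as its name. -/
def cantorNaming : Naming Cantor := fun p ω => ∀ n, p n = (ω n).toNat

/-- Continuous random variables with values in `X`, to be equipped with the Fan metric. -/
def ContRV (X : Type*) [TopologicalSpace X] := C(Cantor, X)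

instance {X : Type*} [TopologicalSpace X] : FunLike (ContRV X) Cantor X :=
  inferInstanceAs (FunLike C(Cantor, X) Cantor X)

variable {X : Type*} [MetricSpace X]

/-- The rationals whose supremum is the Fan distance. -/
def fanSet (Y Z : ContRV X) : Set ℝ :=
  {r | ∃ ε : ℚ, 0 < ε ∧ (ε : ℝ) = r ∧ (ε : ℝ) < coinMeasure.real {ω | (ε : ℝ) < dist (Y ω) (Z ω)}}

/-- The Fan distance of continuous random variables. -/
def fanDist (Y Z : ContRV X) : ℝ := sSup (fanSet Y Z)

theorem fanSet_bddAbove (Y Z : ContRV X) : BddAbove (fanSet Y Z) := by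
  refine ⟨1, ?_⟩
  rintro r ⟨ε, -, rfl, h⟩
  exact h.le.trans measureReal_le_one

theorem fanDist_nonneg (Y Z : ContRV X) : 0 ≤ fanDist Y Z := by
  apply Real.sSup_nonneg
  rintro r ⟨ε, h, rfl, -⟩
  exact_mod_cast h.le

theorem measure_le_of_fanDist_lt (Y Z : ContRV X) {r : ℝ} (h : fanDist Y Z < r) :
    coinMeasure.real {ω | r < dist (Y ω) (Z ω)} ≤ r := by
  obtain ⟨ε, h1, h2⟩ := exists_rat_btwn h
  have h0 : (0 : ℝ) < ε := (fanDist_nonneg Y Z).trans_lt h1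
  by_contra! hc
  refine h1.not_ge (le_csSup (fanSet_bddAbove Y Z) ⟨ε, by exact_mod_cast h0, rfl, ?_⟩)
  refine (h2.trans hc).trans_le (measureReal_mono fun ω hω => ?_)
  exact h2.trans hω

theorem fanDist_triangle (X₁ X₂ X₃ : ContRV X) :
    fanDist X₁ X₃ ≤ fanDist X₁ X₂ + fanDist X₂ X₃ := by
  refine Real.sSup_le ?_ (add_nonneg (fanDist_nonneg _ _) (fanDist_nonneg _ _))
  rintro r ⟨ε, -, rfl, h⟩
  by_contra! hc
  set a := fanDist X₁ X₂
  set b := fanDist X₂ X₃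
  set t := ((ε : ℝ) - (a + b)) / 2 with ht
  have h1 := measure_le_of_fanDist_lt X₁ X₂ (r := a + t) (by linarith)
  have h2 := measure_le_of_fanDist_lt X₂ X₃ (r := b + t) (by linarith)
  have hsub : {ω | (ε : ℝ) < dist (X₁ ω) (X₃ ω)} ⊆
      {ω | a + t < dist (X₁ ω) (X₂ ω)} ∪ {ω | b + t < dist (X₂ ω) (X₃ ω)} := by
    intro ω hω
    by_contra hn
    simp only [Set.mem_union, Set.mem_ofPred_eq, not_or, not_lt] at hn hω
    linarith [dist_triangle (X₁ ω) (X₂ ω) (X₃ ω)]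
  have h3 := (measureReal_mono (μ := coinMeasure) hsub).trans (measureReal_union_le _ _)
  linarith

/-- The Fan metric.  Almost surely equal random variables are at distance zero. -/
instance : PseudoMetricSpace (ContRV X) where
  dist := fanDist
  dist_self Y := by
    have : fanSet Y Y = ∅ := by
      ext r
      simp only [fanSet, dist_self, Set.mem_ofPred_eq, Set.mem_empty_iff_false, iff_false]
      rintro ⟨ε, h, -, h2⟩
      have h' : (0 : ℝ) < ε := by exact_mod_cast h
      simp [h'.le.not_gt] at h2
    change sSup (fanSet Y Y) = 0
    rw [this, Real.sSup_empty]
  dist_comm Y Z := by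
    change sSup (fanSet Y Z) = sSup (fanSet Z Y)
    simp only [fanSet, dist_comm]
  dist_triangle := fanDist_triangle

/-- Measurable random variables with values in `X`: the completion for the Fan metric. -/
abbrev MeasurableRV (X : Type*) [MetricSpace X] := UniformSpace.Completion (ContRV X)

/-- Names of measurable random variables: names of strong Cauchy sequences of continuous random
variables converging to it. -/
def rvNaming (δ : Naming X) : Naming (MeasurableRV X) := fun p Z =>
  ∃ s : ℕ → ContRV X,
    seqNaming (funNaming cantorNaming δ) p (fun n => ⇑(s n)) ∧
    (∀ m n, dist (s m) (s n) < (2⁻¹ : ℝ) ^ min m n) ∧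
    Tendsto (fun n => (s n : MeasurableRV X)) atTop (𝓝 Z)

/-- The inner set `I_ε(U)`: the complement of the closed `ε`-neighbourhood of the complement. -/
def innerSet (ε : ℝ) (U : TopologicalSpace.Opens X) : Set X :=
  (Metric.cthickening ε (U : Set X)ᶜ)ᶜ

/-- The distribution `U ↦ Pr(Z ∈ U)` of a measurable random variable. -/
def distribution (Z : MeasurableRV X) (U : TopologicalSpace.Opens X) : ℝ :=
  sSup {r | ∃ (ε : ℚ) (V : TopologicalSpace.Opens X) (Y : ContRV X),
    0 < ε ∧ (V : Set X) ⊆ innerSet ε U ∧ dist (Y : MeasurableRV X) Z < ε ∧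
    r = coinMeasure.real {ω | Y ω ∈ V} - ε}

end

/-! ### Finite words and finite approximations of associates -/

/-! Computability rests on one formula: if `s n` converges fast to `Z`, then Pr(Z ∈ U) is the
supremum over n of P(s n ∈ I_{2·2⁻ⁿ}(U)) - 2·2⁻ⁿ (`FastConverges.ofReal_distribution`). The event
says that the distance from `s n ω` to the complement of `U` exceeds 2·2⁻ⁿ, which can be semidecided
by running the given associate of the distance function. Stage s of such a run sees only s bits of
`ω`, so the accepted points form a union of cylinders, and their measure is a count divided by 2^s.
Maxima over finitely many pairs (n, s) give an increasing computable sequence with the required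
supremum (`lowerNaming_distribution`).

For the valuation property, `Z` is realised by an actual map. Computability of the distance to
closed sets, with value ∞ at ∅, forces `X` to be proper (`IsComputableMetricSpace.properSpace`): a
finite part of a name of ∅ already certifies that the distance exceeds r, and a decreasing sequence
of closed sets with empty intersection has a member sharing that part. Such a sequence therefore
leaves every ball, so bounded sequences have cluster points. As `X` is then complete, Borel–Cantelli
yields an almost sure limit `T` of the `s n`, and Pr(Z ∈ U) = P(T ∈ U). The law of `T` is a finite
Borel measure, hence modular, and it is Scott continuous on open sets by inner regularity. A
continuous variable is the case of a constant sequence. -/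

@[simp] theorem length_seqPrefix (p : ℕ → ℕ) (k : ℕ) : (seqPrefix p k).length = k := by
  simp [seqPrefix]

theorem getElem?_seqPrefix (p : ℕ → ℕ) (k i : ℕ) :
    (seqPrefix p k)[i]? = if i < k then some (p i) else none := by
  by_cases h : i < k <;> simp [seqPrefix, h]

theorem getElem?_seqPrefix_eq_some {p : ℕ → ℕ} {k i x : ℕ} :
    (seqPrefix p k)[i]? = some x ↔ i < k ∧ p i = x := by
  rw [getElem?_seqPrefix]; split_ifs with h <;> simp [h]

theorem getD_seqPrefix {p : ℕ → ℕ} {k i : ℕ} (h : i < k) : (seqPrefix p k).getD i 0 = p i := by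
  rw [List.getD_eq_getElem?_getD, getElem?_seqPrefix, if_pos h, Option.getD_some]

theorem take_seqPrefix (p : ℕ → ℕ) {j k : ℕ} (h : j ≤ k) :
    (seqPrefix p k).take j = seqPrefix p j := by
  simp [seqPrefix, ← List.map_take, List.take_range, h]

theorem seqPrefix_congr {p p' : ℕ → ℕ} {k : ℕ} (h : ∀ i < k, p i = p' i) :
    seqPrefix p k = seqPrefix p' k := by
  simpa [seqPrefix] using h

theorem seqPrefix_succ (p : ℕ → ℕ) (k : ℕ) : seqPrefix p (k + 1) = seqPrefix p k ++ [p k] := by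
  simp [seqPrefix, List.range_succ]

/-- The first answer other than "read more" in a list of answers, if all earlier ones are known. -/
def firstAnswer (l : List (Option ℕ)) : Option ℕ :=
  (l.getD (l.findIdx fun o => decide (o ≠ some 0)) none).map Nat.pred

theorem firstAnswer_eq_some {l : List (Option ℕ)} {c : ℕ} :
    firstAnswer l = some c ↔
      ∃ k : ℕ, l[k]? = some (some (c + 1)) ∧ ∀ j < k, l[j]? = some (some 0) := by
  induction l with
  | nil => simp [firstAnswer]
  | cons o l ih =>
    by_cases ho : o = some 0
    · have : firstAnswer (o :: l) = firstAnswer l := by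
        simp [firstAnswer, List.findIdx_cons, ho]
      rw [this, ih]
      constructor
      · rintro ⟨k, hk, hj⟩
        refine ⟨k + 1, by simpa using hk, fun j hjk => ?_⟩
        rcases j with _ | j
        · simp [ho]
        · simpa using hj j (by omega)
      · rintro ⟨k, hk, hj⟩
        rcases k with _ | k
        · simp [ho] at hk
        · exact ⟨k, by simpa using hk, fun j hjk => by simpa using hj (j + 1) (by omega)⟩
    · have : firstAnswer (o :: l) = o.map Nat.pred := by
        simp [firstAnswer, List.findIdx_cons, ho]
      rw [this]
      constructor
      · intro h
        refine ⟨0, ?_, by simp⟩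
        rcases o with _ | x
        · simp at h
        · rcases x with _ | x
          · simp at ho
          · simpa using h
      · rintro ⟨k, hk, hj⟩
        rcases k with _ | k
        · have : o = some (c + 1) := by simpa using hk
          simp [this]
        · exact absurd (by simpa using hj 0 (by omega)) ho

/-- The output symbol at position `m` of the associate with known part `a`, after reading at most
the word `w`. -/
def evalAt (a w : List ℕ) (m : ℕ) : Option ℕ :=
  firstAnswer ((List.range (w.length + 1)).map fun j => a[Encodable.encode (m, w.take j)]?)

/-- The output word of the associate with known part `a` on the word `w`. -/
def evalWord (a w : List ℕ) : List ℕ :=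
  (List.range ((List.range a.length).findIdx fun m => (evalAt a w m).isNone)).map
    fun m => (evalAt a w m).getD 0

theorem evalAt_seqPrefix_eq_some {α p : ℕ → ℕ} {s t m c : ℕ} :
    evalAt (seqPrefix α s) (seqPrefix p t) m = some c ↔
      ∃ k ≤ t, (Encodable.encode (m, seqPrefix p k) < s ∧
          tableAnswer α m (seqPrefix p k) = c + 1) ∧
        ∀ j < k, Encodable.encode (m, seqPrefix p j) < s ∧
          tableAnswer α m (seqPrefix p j) = 0 := by
  have key : ∀ j x, ((List.range ((seqPrefix p t).length + 1)).map fun j =>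
      (seqPrefix α s)[Encodable.encode (m, (seqPrefix p t).take j)]?)[j]? = some (some x) ↔
      j ≤ t ∧ Encodable.encode (m, seqPrefix p j) < s ∧ tableAnswer α m (seqPrefix p j) = x := by
    intro j x
    by_cases hj : j ≤ t
    · have : j < t + 1 := by omega
      simp only [length_seqPrefix, List.getElem?_map, List.getElem?_range this, Option.map_some,
        take_seqPrefix p hj, Option.some.injEq, getElem?_seqPrefix_eq_some, hj, true_and,
        tableAnswer]
    · have : ¬ j < t + 1 := by omega
      simp [hj, this]
  rw [evalAt, firstAnswer_eq_some]
  simp only [key]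
  constructor
  · rintro ⟨k, ⟨hk, h⟩, hj⟩
    exact ⟨k, hk, h, fun j hjk => (hj j hjk).2⟩
  · rintro ⟨k, hk, h, hj⟩
    exact ⟨k, ⟨hk, h⟩, fun j hjk => ⟨by omega, hj j hjk⟩⟩

/-- A finite evaluation answers only if all earlier table entries are known to be "read more", so it
stops at the same prefix as the full run. -/
theorem evalAt_sound {α p q : ℕ → ℕ} (h : Transforms α p q) {s t m c : ℕ}
    (hc : evalAt (seqPrefix α s) (seqPrefix p t) m = some c) : c = q m := by
  obtain ⟨k, -, ⟨-, hk⟩, hj⟩ := evalAt_seqPrefix_eq_some.1 hc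
  obtain ⟨k', hk', hj'⟩ := h m
  rcases lt_trichotomy k k' with hlt | rfl | hlt
  · have := hj' k hlt; omega
  · omega
  · have := (hj k' hlt).2; omega

theorem evalAt_complete {α p q : ℕ → ℕ} (h : Transforms α p q) (m : ℕ) :
    ∃ S, ∀ s ≥ S, ∀ t ≥ S, evalAt (seqPrefix α s) (seqPrefix p t) m = some (q m) := by
  obtain ⟨k, hk, hj⟩ := h m
  obtain ⟨B, hB⟩ := ((Finset.range (k + 1)).image
    fun j => Encodable.encode (m, seqPrefix p j)).bddAbove
  have hB' : ∀ j ≤ k, Encodable.encode (m, seqPrefix p j) ≤ B := fun j hjk =>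
    hB (by simpa using ⟨j, by omega, rfl⟩)
  -- The input prefix must contain the `k` letters read, and the table prefix must extend beyond
  -- every code consulted.
  refine ⟨max k (B + 1), fun s hs t ht => evalAt_seqPrefix_eq_some.2 ⟨k, by omega, ⟨?_, hk⟩, ?_⟩⟩
  · have := hB' k le_rfl; omega
  · intro j hjk
    have := hB' j hjk.le
    exact ⟨by omega, hj j hjk⟩

theorem evalWord_sound {α p q : ℕ → ℕ} (h : Transforms α p q) (s t : ℕ) :
    evalWord (seqPrefix α s) (seqPrefix p t) =
      seqPrefix q (evalWord (seqPrefix α s) (seqPrefix p t)).length := by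
  simp only [evalWord, List.length_map, List.length_range, seqPrefix.eq_def q]
  refine List.map_congr_left fun m hm => ?_
  have hm' := List.not_of_lt_findIdx (List.mem_range.1 hm)
  simp only [List.getElem_range, Option.isNone_eq_false_iff,
    Option.isSome_iff_exists] at hm'
  obtain ⟨c, hc⟩ := hm'
  rw [hc, Option.getD_some]
  exact evalAt_sound h hc

theorem evalWord_complete {α p q : ℕ → ℕ} (h : Transforms α p q) (K : ℕ) :
    ∃ S, ∀ s ≥ S, ∀ t ≥ S, K ≤ (evalWord (seqPrefix α s) (seqPrefix p t)).length := by
  choose S hS using evalAt_complete h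
  obtain ⟨B, hB⟩ := ((Finset.range K).image S).bddAbove
  have hB' : ∀ m < K, S m ≤ B := fun m hm => hB (by simpa using ⟨m, hm, rfl⟩)
  refine ⟨max K B, fun s hs t ht => ?_⟩
  simp only [evalWord, List.length_map, List.length_range]
  by_contra! hlt
  have hlen : (List.range (seqPrefix α s).length).findIdx (fun m =>
      (evalAt (seqPrefix α s) (seqPrefix p t) m).isNone) <
      (List.range (seqPrefix α s).length).length := by
    simp only [List.length_range, length_seqPrefix] at hlt ⊢
    omega
  have h1 := List.findIdx_getElem (w := hlen)
  rw [List.getElem_range] at h1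
  have := hB' _ hlt
  rw [hS _ s (by omega) t (by omega)] at h1
  simp at h1

/-- The pairing of two words. -/
def pairWord (x w : List ℕ) : List ℕ :=
  (List.range (min x.length w.length)).map fun i => Nat.pair (x.getD i 0) (w.getD i 0)

theorem pairWord_seqPrefix (x w : ℕ → ℕ) (j k : ℕ) :
    pairWord (seqPrefix x j) (seqPrefix w k) =
      seqPrefix (fun i => Nat.pair (x i) (w i)) (min j k) := by
  simp only [pairWord, length_seqPrefix, seqPrefix.eq_def (fun i => Nat.pair (x i) (w i))]
  refine List.map_congr_left fun i hi => ?_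
  have := List.mem_range.1 hi
  rw [getD_seqPrefix (by omega), getD_seqPrefix (by omega)]

/-- The known part of the `n`-th sequence in a sequence of sequences at stage `s`. -/
def columnWord (v : List ℕ) (n s : ℕ) : List ℕ :=
  (List.range (s.sqrt - n)).map fun k => v.getD (Nat.pair n k) 0

/-- The cut-off `s.sqrt - n` keeps every index `Nat.pair n k` below `s`; hence stage `s` does not
depend on how much more of the name is known. -/
theorem columnWord_seqPrefix (p : ℕ → ℕ) {n s t : ℕ} (h : s ≤ t) :
    columnWord (seqPrefix p t) n s = seqPrefix (fun k => p (Nat.pair n k)) (s.sqrt - n) := by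
  simp only [columnWord, seqPrefix.eq_def (fun k => p (Nat.pair n k))]
  refine List.map_congr_left fun k hk => getD_seqPrefix ?_
  have hk := List.mem_range.1 hk
  have h1 := Nat.pair_lt_max_add_one_sq n k
  have h2 : max n k + 1 ≤ s.sqrt := by omega
  have h3 := Nat.sqrt_le' s
  have h4 := Nat.pow_le_pow_left h2 2
  omega

/-- The word of length `s` consisting of the binary digits of `c`. -/
def bitWord (c s : ℕ) : List ℕ := (List.range s).map fun i => c / 2 ^ i % 2

/-- Stage `s` of the test whether the distance of the `n`-th random variable to the complement of
an open set exceeds `2 * 2⁻ⁿ`.  Here `a`, `e`, `b`, `u` are known parts of the associate of the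
distance function, of the associate of the random variable, of the point of Cantor space and of the
name of the open set. -/
def Accepts (n : ℕ) (a e b u : List ℕ) : Prop :=
  ∃ y ∈ evalWord a (pairWord (evalWord e b) u), 2 * (y.unpair.2 + 1) < y.unpair.1 * 2 ^ n

open scoped Classical in
/-- The number of words of length `s` which are accepted. -/
noncomputable def acceptCount (a v u : List ℕ) (n s : ℕ) : ℕ :=
  ((List.range (2 ^ s)).filter fun c =>
    Accepts n (a.take s) (columnWord v n s) (bitWord c s) (u.take s)).length

/-- The numerator, with denominator `2 ^ t`, of the lower bound at stage `t`. -/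
noncomputable def lowerNum (a v u : List ℕ) (t : ℕ) : ℕ :=
  (List.range t).foldl (fun m c => max m (2 ^ (t - c.unpair.1) *
    (acceptCount a v u c.unpair.2 c.unpair.1 - 2 ^ (c.unpair.1 + 1 - c.unpair.2)))) 0

/-! ### Computability of the finite approximations -/

section Computability

variable {α : Type*} [Primcodable α]

theorem Primrec.nat_pow : Primrec₂ ((· ^ ·) : ℕ → ℕ → ℕ) :=
  Primrec₂.unpaired'.1 Nat.Primrec.pow

theorem primrec_firstAnswer : Primrec firstAnswer := by
  have hp : Primrec₂ fun (_ : List (Option ℕ)) (o : Option ℕ) => decide (o ≠ some 0) := by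
    have : PrimrecPred fun o : Option ℕ => o ≠ some 0 :=
      (Primrec.eq.comp Primrec.id (Primrec.const _)).not
    exact this.decide.comp Primrec.snd
  exact Primrec.option_map
    ((Primrec.list_getD none).comp Primrec.id (Primrec.list_findIdx Primrec.id hp))
    (Primrec.pred.comp Primrec.snd)

theorem primrec_evalAt {f g : α → List ℕ} {m : α → ℕ} (hf : Primrec f) (hg : Primrec g)
    (hm : Primrec m) : Primrec fun x => evalAt (f x) (g x) (m x) := by
  refine primrec_firstAnswer.comp (Primrec.list_map
    (Primrec.list_range.comp (Primrec.succ.comp (Primrec.list_length.comp hg))) ?_)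
  refine Primrec.list_getElem?.comp (hf.comp Primrec.fst) (Primrec.encode.comp
    ((hm.comp Primrec.fst).pair (Primrec.list_take.comp Primrec.snd (hg.comp Primrec.fst))))

theorem primrec_evalWord {f g : α → List ℕ} (hf : Primrec f) (hg : Primrec g) :
    Primrec fun x => evalWord (f x) (g x) := by
  have h : Primrec fun z : α × ℕ => evalAt (f z.1) (g z.1) z.2 :=
    primrec_evalAt (hf.comp Primrec.fst) (hg.comp Primrec.fst) Primrec.snd
  have hn : Primrec fun z : α × ℕ => (evalAt (f z.1) (g z.1) z.2).isNone :=
    (Primrec.not.comp (Primrec.option_isSome.comp h)).of_eq fun z => by simp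
  exact Primrec.list_map (Primrec.list_range.comp (Primrec.list_findIdx
    (Primrec.list_range.comp (Primrec.list_length.comp hf)) hn))
    (Primrec.option_getD.comp h (Primrec.const 0))

theorem primrec_pairWord {f g : α → List ℕ} (hf : Primrec f) (hg : Primrec g) :
    Primrec fun x => pairWord (f x) (g x) :=
  Primrec.list_map (Primrec.list_range.comp (Primrec.nat_min.comp (Primrec.list_length.comp hf)
    (Primrec.list_length.comp hg)))
    (Primrec₂.natPair.comp
      ((Primrec.list_getD 0).comp (hf.comp Primrec.fst) Primrec.snd)
      ((Primrec.list_getD 0).comp (hg.comp Primrec.fst) Primrec.snd))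

theorem primrec_columnWord {f : α → List ℕ} {n s : α → ℕ} (hf : Primrec f) (hn : Primrec n)
    (hs : Primrec s) : Primrec fun x => columnWord (f x) (n x) (s x) :=
  Primrec.list_map (Primrec.list_range.comp (Primrec.nat_sub.comp (Primrec.nat_sqrt.comp hs) hn))
    ((Primrec.list_getD 0).comp (hf.comp Primrec.fst)
      (Primrec₂.natPair.comp (hn.comp Primrec.fst) Primrec.snd))

theorem primrec_bitWord {c s : α → ℕ} (hc : Primrec c) (hs : Primrec s) :
    Primrec fun x => bitWord (c x) (s x) :=
  Primrec.list_map (Primrec.list_range.comp hs)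
    (Primrec.nat_mod.comp (Primrec.nat_div.comp (hc.comp Primrec.fst)
      (Primrec.nat_pow.comp (Primrec.const 2) Primrec.snd)) (Primrec.const 2))

theorem primrecPred_accepts {n : α → ℕ} {a e b u : α → List ℕ} (hn : Primrec n) (ha : Primrec a)
    (he : Primrec e) (hb : Primrec b) (hu : Primrec u) :
    PrimrecPred fun x => Accepts (n x) (a x) (e x) (b x) (u x) := by
  have hR : PrimrecRel fun y n : ℕ => 2 * (y.unpair.2 + 1) < y.unpair.1 * 2 ^ n := by
    have hy : Primrec fun z : ℕ × ℕ => z.1.unpair := Primrec.unpair.comp Primrec.fst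
    exact Primrec.nat_lt.comp
      (Primrec.nat_mul.comp (Primrec.const 2) (Primrec.succ.comp (Primrec.snd.comp hy)))
      (Primrec.nat_mul.comp (Primrec.fst.comp hy)
        (Primrec.nat_pow.comp (Primrec.const 2) Primrec.snd))
  exact hR.exists_mem_list.comp
    (primrec_evalWord ha (primrec_pairWord (primrec_evalWord he hb) hu)) hn

theorem primrec_acceptCount {a v u : α → List ℕ} {n s : α → ℕ} (ha : Primrec a) (hv : Primrec v)
    (hu : Primrec u) (hn : Primrec n) (hs : Primrec s) :
    Primrec fun x => acceptCount (a x) (v x) (u x) (n x) (s x) := by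
  classical
  have hR : PrimrecRel fun (c : ℕ) (x : α) => Accepts (n x) ((a x).take (s x))
      (columnWord (v x) (n x) (s x)) (bitWord c (s x)) ((u x).take (s x)) := by
    have hs' : Primrec fun z : ℕ × α => s z.2 := hs.comp Primrec.snd
    exact primrecPred_accepts (hn.comp Primrec.snd)
      (Primrec.list_take.comp hs' (ha.comp Primrec.snd))
      (primrec_columnWord (hv.comp Primrec.snd) (hn.comp Primrec.snd) hs')
      (primrec_bitWord Primrec.fst hs') (Primrec.list_take.comp hs' (hu.comp Primrec.snd))
  refine (Primrec.list_length.comp (hR.listFilter.comp (Primrec.list_range.comp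
    (Primrec.nat_pow.comp (Primrec.const 2) hs)) Primrec.id)).of_eq fun x => ?_
  simp only [acceptCount, id]

theorem primrec_lowerNum {a v u : α → List ℕ} {t : α → ℕ} (ha : Primrec a) (hv : Primrec v)
    (hu : Primrec u) (ht : Primrec t) : Primrec fun x => lowerNum (a x) (v x) (u x) (t x) := by
  have hx : Primrec fun z : α × ℕ × ℕ => z.1 := Primrec.fst
  have hc : Primrec fun z : α × ℕ × ℕ => z.2.2.unpair :=
    Primrec.unpair.comp (Primrec.snd.comp Primrec.snd)
  have hs := Primrec.fst.comp hc
  have hn := Primrec.snd.comp hc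
  have h2 : Primrec fun _ : α × ℕ × ℕ => 2 := Primrec.const 2
  have hcount : Primrec fun z : α × ℕ × ℕ =>
      acceptCount (a z.1) (v z.1) (u z.1) z.2.2.unpair.2 z.2.2.unpair.1 :=
    primrec_acceptCount (ha.comp hx) (hv.comp hx) (hu.comp hx) hn hs
  have hstep : Primrec₂ fun (x : α) (z : ℕ × ℕ) => max z.1 (2 ^ (t x - z.2.unpair.1) *
      (acceptCount (a x) (v x) (u x) z.2.unpair.2 z.2.unpair.1 -
        2 ^ (z.2.unpair.1 + 1 - z.2.unpair.2))) :=
    Primrec.nat_max.comp (Primrec.fst.comp Primrec.snd) (Primrec.nat_mul.comp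
      (Primrec.nat_pow.comp h2 (Primrec.nat_sub.comp (ht.comp hx) hs))
      (Primrec.nat_sub.comp hcount
        (Primrec.nat_pow.comp h2 (Primrec.nat_sub.comp (Primrec.succ.comp hs) hn))))
  exact Primrec.list_foldl (Primrec.list_range.comp ht) (Primrec.const 0) hstep

theorem computable_seqPrefix {α : ℕ → ℕ} (h : Computable α) : Computable (seqPrefix α) := by
  have hstep : Computable₂ fun (_ : ℕ) (z : ℕ × List ℕ) => z.2 ++ [α z.1] :=
    Computable.list_concat.comp (Computable.snd.comp Computable.snd)
      (h.comp (Computable.fst.comp Computable.snd))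
  have : Computable fun k : ℕ => (Nat.rec [] (fun i l => l ++ [α i]) k : List ℕ) :=
    Computable.nat_rec Computable.id (Computable.const []) hstep
  refine this.of_eq fun k => ?_
  induction k with
  | zero => rfl
  | succ k ih => rw [seqPrefix_succ, ← ih]

/-- The table of an associate which, on a name with prefix `v`, outputs as symbol number
`encode z` the value `f z v`, reading as many input symbols as `z` has letters. -/
def tableOfAnswers (f : ℕ × List ℕ → List ℕ → ℕ) (i : ℕ) : ℕ :=
  ((Encodable.decode i : Option (ℕ × List ℕ)).map fun y =>
    ((Encodable.decode y.1 : Option (ℕ × List ℕ)).map fun z =>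
      if y.2.length < z.2.length then 0 else 1 + f z y.2).getD 1).getD 0

theorem computable_tableOfAnswers {f : ℕ × List ℕ → List ℕ → ℕ} (hf : Computable₂ f) :
    Computable (tableOfAnswers f) := by
  have hyz : Computable₂ fun (x : ℕ × ℕ × List ℕ) (z : ℕ × List ℕ) =>
      if x.2.2.length < z.2.length then 0 else 1 + f z x.2.2 := by
    have hw : Primrec fun x : ((ℕ × ℕ × List ℕ) × ℕ × List ℕ) => x.1.2.2 :=
      Primrec.snd.comp (Primrec.snd.comp Primrec.fst)
    have hlt : PrimrecPred fun x : ((ℕ × ℕ × List ℕ) × ℕ × List ℕ) =>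
        x.1.2.2.length < x.2.2.length :=
      Primrec.nat_lt.comp (Primrec.list_length.comp hw)
        (Primrec.list_length.comp (Primrec.snd.comp Primrec.snd))
    have hA : Computable fun x : ((ℕ × ℕ × List ℕ) × ℕ × List ℕ) => f x.2 x.1.2.2 :=
      hf.comp Computable.snd hw.to_comp
    have hadd : Computable fun x : ((ℕ × ℕ × List ℕ) × ℕ × List ℕ) => 1 + f x.2 x.1.2.2 :=
      Primrec.nat_add.to_comp.comp (Computable.const 1) hA
    refine (Computable.cond hlt.decide.to_comp (Computable.const 0) hadd).of_eq fun x => ?_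
    simp [Bool.cond_decide]
  have hdec : Computable fun x : ℕ × ℕ × List ℕ =>
      (Encodable.decode x.2.1 : Option (ℕ × List ℕ)) :=
    Computable.decode.comp (Computable.fst.comp Computable.snd)
  have hy : Computable₂ fun (_ : ℕ) (y : ℕ × List ℕ) =>
      ((Encodable.decode y.1 : Option (ℕ × List ℕ)).map fun z =>
        if y.2.length < z.2.length then 0 else 1 + f z y.2).getD 1 :=
    Computable.option_getD (Computable.option_map hdec hyz) (Computable.const 1)
  exact Computable.option_getD (Computable.option_map Computable.decode hy) (Computable.const 0)

/-- The answer of the distribution of a random variable with known part `v` of its name, for output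
position `z.1`, after having read the word `z.2` of a name of an open set, where `a` is the known
part of the associate of the distance function. -/
noncomputable def distributionAnswer (a : List ℕ) (z : ℕ × List ℕ) (v : List ℕ) : ℕ :=
  if z.2.length < z.1 then 0
  else 1 + Nat.pair (lowerNum a v z.2 z.2.length) (2 ^ z.2.length - 1)

theorem primrec_distributionAnswer :
    Primrec fun x : List ℕ × (ℕ × List ℕ) × List ℕ => distributionAnswer x.1 x.2.1 x.2.2 := by
  have hz : Primrec fun x : List ℕ × (ℕ × List ℕ) × List ℕ => x.2.1 :=
    Primrec.fst.comp Primrec.snd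
  have hw : Primrec fun x : List ℕ × (ℕ × List ℕ) × List ℕ => x.2.1.2 := Primrec.snd.comp hz
  have hlen : Primrec fun x : List ℕ × (ℕ × List ℕ) × List ℕ => x.2.1.2.length :=
    Primrec.list_length.comp hw
  have hlow := primrec_lowerNum Primrec.fst (Primrec.snd.comp Primrec.snd) hw hlen
  have hden : Primrec fun x : List ℕ × (ℕ × List ℕ) × List ℕ => 2 ^ x.2.1.2.length - 1 :=
    Primrec.nat_sub.comp (Primrec.nat_pow.comp (Primrec.const 2) hlen) (Primrec.const 1)
  exact Primrec.ite (Primrec.nat_lt.comp hlen (Primrec.fst.comp hz)) (Primrec.const 0)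
    (Primrec.nat_add.comp (Primrec.const 1) (Primrec₂.natPair.comp hlow hden))

/-- The associate `α` is only computable, whereas the simulation is primitive recursive; `α`
therefore enters as a finite prefix passed as data. -/
theorem computable_comp_seqPrefix {α : ℕ → ℕ} (h : Computable α)
    {F : List ℕ → ℕ × List ℕ → List ℕ → ℕ}
    (hF : Primrec fun x : List ℕ × (ℕ × List ℕ) × List ℕ => F x.1 x.2.1 x.2.2) :
    Computable₂ fun (z : ℕ × List ℕ) (v : List ℕ) => F (seqPrefix α z.2.length) z v := by
  have hlen : Primrec fun x : (ℕ × List ℕ) × List ℕ => x.1.2.length :=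
    Primrec.list_length.comp (Primrec.snd.comp Primrec.fst)
  have hpre : Computable fun x : (ℕ × List ℕ) × List ℕ => seqPrefix α x.1.2.length :=
    (computable_seqPrefix h).comp hlen.to_comp
  have hpair : Computable fun x : (ℕ × List ℕ) × List ℕ => (seqPrefix α x.1.2.length, x) :=
    hpre.pair Computable.id
  have hF' := hF.to_comp
  have hcomp := hF'.comp hpair
  exact hcomp

/-- A table for the distribution map, given an associate `α` of the distance function. -/
noncomputable def distributionTable (α : ℕ → ℕ) : ℕ → ℕ :=
  tableOfAnswers fun z => distributionAnswer (seqPrefix α z.2.length) z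

theorem computable_distributionTable {α : ℕ → ℕ} (h : Computable α) :
    Computable (distributionTable α) :=
  computable_tableOfAnswers (computable_comp_seqPrefix h primrec_distributionAnswer)

end Computability

/-- Currying: `q` is itself a table, whose entry for a word of length t needs only t letters of `p`.
The second component `2 ^ t - 1` encodes the denominator 2^t, since `ratOfCode` adds one. -/
theorem transforms_distributionTable (α p : ℕ → ℕ) :
    ∃ q : ℕ → ℕ, Transforms (distributionTable α) p q ∧ ∀ u : ℕ → ℕ,
      Transforms q u fun t => Nat.pair
        (lowerNum (seqPrefix α t) (seqPrefix p t) (seqPrefix u t) t) (2 ^ t - 1) := by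
  refine ⟨fun i => ((Encodable.decode i : Option (ℕ × List ℕ)).map fun z =>
    distributionAnswer (seqPrefix α z.2.length) z (seqPrefix p z.2.length)).getD 0, fun i => ?_, fun u t => ?_⟩
  · simp only [tableAnswer, distributionTable, tableOfAnswers, Encodable.encodek, Option.map_some,
      Option.getD_some, length_seqPrefix]
    rcases hz : (Encodable.decode i : Option (ℕ × List ℕ)) with _ | z
    -- An entry that codes no pair is answered at once by 1, that is, by the output 0, matching the
    -- default value in `q`.
    · exact ⟨0, by simp, by simp⟩
    · refine ⟨z.2.length, by simp [add_comm], fun j hj => by simp [hj]⟩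
  · refine ⟨t, ?_, fun j hj => ?_⟩
    · simp [tableAnswer, distributionAnswer, add_comm]
    · simp [tableAnswer, distributionAnswer, hj]

/-! ### The measure of sets given by finite words -/

/-- The canonical name of a point of Cantor space. -/
def cantorName (ω : Cantor) : ℕ → ℕ := fun n => (ω n).toNat

theorem cantorNaming_cantorName (ω : Cantor) : cantorNaming (cantorName ω) ω := fun _ => rfl

theorem seqPrefix_cantorName_eq_iff {ω ω' : Cantor} {s : ℕ} :
    seqPrefix (cantorName ω) s = seqPrefix (cantorName ω') s ↔ ∀ i < s, ω i = ω' i := by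
  have h : Function.Injective Bool.toNat := by decide
  simp [seqPrefix, cantorName, h.eq_iff]

theorem coinMeasure_cylinder (ω₀ : Cantor) (s : ℕ) :
    coinMeasure {ω | seqPrefix (cantorName ω) s = seqPrefix (cantorName ω₀) s} = (2 ^ s)⁻¹ := by
  have hset : {ω | seqPrefix (cantorName ω) s = seqPrefix (cantorName ω₀) s} =
      (↑(Finset.range s) : Set ℕ).pi fun i => {ω₀ i} := by
    ext ω
    simp [seqPrefix_cantorName_eq_iff, Set.mem_pi]
  have hpt : ∀ b : Bool, (PMF.uniformOfFintype Bool).toMeasure {b} = 2⁻¹ := fun b => by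
    rw [PMF.toMeasure_apply_singleton _ _ (measurableSet_singleton b)]
    simp
  rw [hset, coinMeasure, Measure.infinitePi_pi _ fun i _ => measurableSet_singleton _]
  simp [hpt, ENNReal.inv_pow]

theorem bitWord_eq_seqPrefix_cantorName (c s : ℕ) :
    bitWord c s = seqPrefix (cantorName fun i => decide (c / 2 ^ i % 2 = 1)) s := by
  refine List.map_congr_left fun i _ => ?_
  rcases Nat.mod_two_eq_zero_or_one (c / 2 ^ i) with h | h <;> simp [cantorName, h]

theorem bitWord_injOn (s : ℕ) : Set.InjOn (fun c => bitWord c s) (Set.Iio (2 ^ s)) := by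
  intro c hc d hd h
  have h' : ∀ i < s, c / 2 ^ i % 2 = d / 2 ^ i % 2 := by simpa [bitWord] using h
  -- The inverse of `finFunctionFinEquiv` is the expansion in base 2.
  have : (finFunctionFinEquiv (m := 2) (n := s)).symm ⟨c, hc⟩ =
      finFunctionFinEquiv.symm ⟨d, hd⟩ := by
    ext i
    exact h' i i.2
  exact congrArg Fin.val (finFunctionFinEquiv.symm.injective this)

theorem exists_bitWord_eq (ω : Cantor) (s : ℕ) :
    ∃ c < 2 ^ s, bitWord c s = seqPrefix (cantorName ω) s := by
  let f : Fin s → Fin 2 := fun i => ⟨(ω i).toNat, Bool.toNat_lt _⟩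
  refine ⟨finFunctionFinEquiv f, (finFunctionFinEquiv f).2, List.map_congr_left fun i hi => ?_⟩
  have h := congrFun (finFunctionFinEquiv.symm_apply_apply f) ⟨i, List.mem_range.1 hi⟩
  exact congrArg Fin.val h

theorem measurableSet_cylinder (ω₀ : Cantor) (s : ℕ) :
    MeasurableSet {ω | seqPrefix (cantorName ω) s = seqPrefix (cantorName ω₀) s} := by
  have hset : {ω | seqPrefix (cantorName ω) s = seqPrefix (cantorName ω₀) s} =
      (↑(Finset.range s) : Set ℕ).pi fun i => {ω₀ i} := by
    ext ω
    simp [seqPrefix_cantorName_eq_iff, Set.mem_pi]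
  rw [hset]
  exact MeasurableSet.pi (Finset.countable_toSet _) fun i _ => measurableSet_singleton _

theorem setOf_seqPrefix_eq_biUnion (S : List ℕ → Prop) [DecidablePred S] (s : ℕ) :
    {ω | S (seqPrefix (cantorName ω) s)} =
      ⋃ c ∈ (Finset.range (2 ^ s)).filter (fun c => S (bitWord c s)),
        {ω | seqPrefix (cantorName ω) s = bitWord c s} := by
  ext ω
  simp only [Set.mem_ofPred_eq, Finset.mem_filter, Finset.mem_range, Set.mem_iUnion, exists_prop]
  constructor
  · intro h
    obtain ⟨c, hc, hω⟩ := exists_bitWord_eq ω s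
    exact ⟨c, ⟨hc, by rwa [hω]⟩, hω.symm⟩
  · rintro ⟨c, ⟨-, hS⟩, hω⟩
    rwa [hω]

/-- An event determined by `s` bits is a disjoint union of cylinders of mass 2⁻ˢ, one for each
accepted code; this turns counting into measure. -/
theorem coinMeasure_seqPrefix (S : List ℕ → Prop) [DecidablePred S] (s : ℕ) :
    coinMeasure.real {ω | S (seqPrefix (cantorName ω) s)} =
      ((List.range (2 ^ s)).filter fun c => S (bitWord c s)).length / 2 ^ s := by
  have hcard : ((List.range (2 ^ s)).filter fun c => S (bitWord c s)).length =
      ((Finset.range (2 ^ s)).filter fun c => S (bitWord c s)).card := rfl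
  rw [hcard, setOf_seqPrefix_eq_biUnion, measureReal_biUnion_finset]
  · have : ∀ c, coinMeasure.real {ω | seqPrefix (cantorName ω) s = bitWord c s} = (2 ^ s)⁻¹ := by
      intro c
      rw [bitWord_eq_seqPrefix_cantorName, Measure.real, coinMeasure_cylinder]
      simp
    simp [this, div_eq_mul_inv]
  · intro c hc d hd hcd
    refine Set.disjoint_left.2 fun ω h1 h2 => hcd (bitWord_injOn s ?_ ?_ (h1.symm.trans h2))
    · simpa using (Finset.mem_filter.1 hc).1
    · simpa using (Finset.mem_filter.1 hd).1
  · intro c _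
    rw [bitWord_eq_seqPrefix_cantorName]
    exact measurableSet_cylinder _ s

/-! ### The distribution along a strong Cauchy sequence -/

section Distribution

variable {X : Type*} [MetricSpace X]

theorem mem_innerSet {ε : ℝ} {U : TopologicalSpace.Opens X} {x : X} :
    x ∈ innerSet ε U ↔ ENNReal.ofReal ε < Metric.infEDist x (U : Set X)ᶜ := by
  simp [innerSet, Metric.mem_cthickening_iff]

theorem innerSet_shrink {ε ε' r : ℝ} {U : TopologicalSpace.Opens X} {x y : X} (hr : 0 ≤ r)
    (hε' : 0 ≤ ε') (h : r + ε' ≤ ε) (hx : x ∈ innerSet ε U) (hxy : dist x y ≤ ε') :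
    y ∈ innerSet r U := by
  rw [mem_innerSet] at hx ⊢
  by_contra! hy
  refine hx.not_ge (Metric.infEDist_le_edist_add_infEDist (y := y) |>.trans ?_)
  calc edist x y + Metric.infEDist y (U : Set X)ᶜ
      ≤ ENNReal.ofReal ε' + ENNReal.ofReal r := by
        gcongr
        rw [edist_dist]
        exact ENNReal.ofReal_le_ofReal hxy
    _ = ENNReal.ofReal (r + ε') := by rw [← ENNReal.ofReal_add hε' hr, add_comm]
    _ ≤ ENNReal.ofReal ε := ENNReal.ofReal_le_ofReal h

theorem mem_of_mem_innerSet {ε : ℝ} {U : TopologicalSpace.Opens X} {x y : X} (hε : 0 ≤ ε)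
    (hx : x ∈ innerSet ε U) (hxy : dist x y ≤ ε) : y ∈ U := by
  have hy : y ∈ innerSet 0 U := innerSet_shrink le_rfl hε (by simp) hx hxy
  by_contra hn
  rw [mem_innerSet, Metric.infEDist_zero_of_mem (by simpa using hn)] at hy
  simp at hy

/-- The set `I_ε(U)` as an open set. -/
def innerOpens (ε : ℝ) (U : TopologicalSpace.Opens X) : TopologicalSpace.Opens X :=
  ⟨innerSet ε U, Metric.isClosed_cthickening.isOpen_compl⟩

/-- The lower bounds whose supremum is the distribution. -/
def distributionSet (Z : MeasurableRV X) (U : TopologicalSpace.Opens X) : Set ℝ :=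
  {r | ∃ (ε : ℚ) (V : TopologicalSpace.Opens X) (Y : ContRV X),
    0 < ε ∧ (V : Set X) ⊆ innerSet ε U ∧ dist (Y : MeasurableRV X) Z < ε ∧
    r = coinMeasure.real {ω | Y ω ∈ V} - ε}

theorem le_one_of_mem_distributionSet {Z : MeasurableRV X} {U : TopologicalSpace.Opens X} {r : ℝ}
    (hr : r ∈ distributionSet Z U) : r ≤ 1 := by
  obtain ⟨ε, V, Y, hε, -, -, rfl⟩ := hr
  have h1 : (0 : ℝ) < ε := by exact_mod_cast hε
  have h2 : coinMeasure.real {ω | Y ω ∈ V} ≤ 1 := measureReal_le_one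
  linarith

theorem le_distribution {Z : MeasurableRV X} {U V : TopologicalSpace.Opens X} {Y : ContRV X}
    {ε : ℚ} (hε : 0 < ε) (hV : (V : Set X) ⊆ innerSet ε U) (hY : dist (Y : MeasurableRV X) Z < ε) :
    coinMeasure.real {ω | Y ω ∈ V} - ε ≤ distribution Z U :=
  le_csSup ⟨1, fun _ => le_one_of_mem_distributionSet⟩ ⟨ε, V, Y, hε, hV, hY, rfl⟩

theorem distribution_le_one (Z : MeasurableRV X) (U : TopologicalSpace.Opens X) :
    distribution Z U ≤ 1 :=
  Real.sSup_le (fun _ => le_one_of_mem_distributionSet) zero_le_one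

theorem exists_dist_lt (Z : MeasurableRV X) {ε : ℝ} (hε : 0 < ε) :
    ∃ Y : ContRV X, dist (Y : MeasurableRV X) Z < ε := by
  obtain ⟨Y, hY⟩ := Metric.denseRange_iff.1 UniformSpace.Completion.denseRange_coe Z ε hε
  exact ⟨Y, by rwa [dist_comm]⟩

/-- Testing with the empty `V` gives the lower bound -ε for arbitrarily small ε. -/
theorem distribution_nonneg (Z : MeasurableRV X) (U : TopologicalSpace.Opens X) :
    0 ≤ distribution Z U := by
  refine le_of_forall_lt fun c hc => ?_
  obtain ⟨ε, h1, h2⟩ := exists_rat_btwn (neg_pos.2 hc)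
  have hε : 0 < ε := by exact_mod_cast h1
  obtain ⟨Y, hY⟩ := exists_dist_lt Z h1
  have := le_distribution (U := U) (V := ⊥) hε (by simp) hY
  have h0 : coinMeasure.real {ω | Y ω ∈ (⊥ : TopologicalSpace.Opens X)} = 0 := by simp
  linarith

/-- The sequence `s` converges fast to `Z` in the Fan metric. -/
structure FastConverges (s : ℕ → ContRV X) (Z : MeasurableRV X) : Prop where
  dist_lt : ∀ m n, dist (s m) (s n) < (2⁻¹ : ℝ) ^ min m n
  tendsto : Tendsto (fun n => (s n : MeasurableRV X)) atTop (𝓝 Z)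

theorem exists_fastConverges (Z : MeasurableRV X) : ∃ s : ℕ → ContRV X, FastConverges s Z := by
  -- The exponent `n + 1` lets two errors add up to less than `2⁻¹ ^ min m n`.
  have hpos : ∀ n : ℕ, (0 : ℝ) < 2⁻¹ ^ (n + 1) := fun n => by positivity
  choose s hs using fun n => exists_dist_lt Z (hpos n)
  refine ⟨s, fun m n => ?_, ?_⟩
  · rw [← UniformSpace.Completion.dist_eq]
    have h1 := dist_triangle_right (s m : MeasurableRV X) (s n) Z
    have h2 : ∀ k, min m n ≤ k → (2⁻¹ : ℝ) ^ (k + 1) ≤ 2⁻¹ ^ (min m n + 1) := fun k hk =>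
      pow_le_pow_of_le_one (by norm_num) (by norm_num) (by omega)
    have h3 := h2 m (min_le_left _ _)
    have h4 := h2 n (min_le_right _ _)
    have h5 : (2⁻¹ : ℝ) ^ (min m n + 1) = 2⁻¹ ^ min m n / 2 := by rw [pow_succ]; ring
    linarith [hs m, hs n]
  · rw [tendsto_iff_dist_tendsto_zero]
    refine squeeze_zero (fun _ => dist_nonneg) (fun n => (hs n).le) ?_
    exact (tendsto_pow_atTop_nhds_zero_of_lt_one (by norm_num) (by norm_num)).comp
      (tendsto_add_atTop_nat 1)

theorem FastConverges.dist_le {s : ℕ → ContRV X} {Z : MeasurableRV X} (h : FastConverges s Z)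
    (n : ℕ) : dist (s n : MeasurableRV X) Z ≤ 2⁻¹ ^ n := by
  refine le_of_tendsto ((tendsto_const_nhds (x := (s n : MeasurableRV X))).dist h.tendsto) ?_
  filter_upwards [eventually_ge_atTop n] with m hm
  rw [UniformSpace.Completion.dist_eq]
  simpa [hm] using (h.dist_lt n m).le

theorem tendsto_two_mul_inv_two_pow : Tendsto (fun n : ℕ => 2 * (2⁻¹ : ℝ) ^ n) atTop (𝓝 0) := by
  simpa using (tendsto_pow_atTop_nhds_zero_of_lt_one (r := (2⁻¹ : ℝ)) (by norm_num)
    (by norm_num)).const_mul 2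

/-- The probability that the `n`-th term lies in the open set, with a margin. -/
noncomputable def innerProb (s : ℕ → ContRV X) (U : TopologicalSpace.Opens X) (n : ℕ) : ℝ :=
  coinMeasure.real {ω | s n ω ∈ innerSet (2 * 2⁻¹ ^ n) U}

/-- The factor 2 is needed because the limit satisfies only the weak bound `dist (s n) Z ≤ 2⁻¹ ^ n`,
while the definition of the distribution asks for a strict one. -/
theorem FastConverges.innerProb_sub_le {s : ℕ → ContRV X} {Z : MeasurableRV X}
    (h : FastConverges s Z) (U : TopologicalSpace.Opens X) (n : ℕ) :
    innerProb s U n - 2 * 2⁻¹ ^ n ≤ distribution Z U := by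
  have hpos : (0 : ℝ) < 2⁻¹ ^ n := by positivity
  have := le_distribution (Z := Z) (U := U) (V := innerOpens (2 * 2⁻¹ ^ n) U) (Y := s n)
    (ε := 2 * 2⁻¹ ^ n) (by positivity) (by push_cast; exact le_rfl)
    (by push_cast; linarith [h.dist_le n])
  push_cast at this
  exact this

/-- Choose r strictly between the distance of `Y` to `Z` and ε. Replacing `Y` by `s n` costs
probability r and margin r, and the remaining ε - r eventually absorbs 2·2⁻ⁿ. -/
theorem FastConverges.eventually_le {s : ℕ → ContRV X} {Z : MeasurableRV X}
    (h : FastConverges s Z) {U : TopologicalSpace.Opens X} {r : ℝ} (hr : r ∈ distributionSet Z U) :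
    ∀ᶠ n in atTop, r ≤ innerProb s U n - 2 * 2⁻¹ ^ n := by
  obtain ⟨ε, V, Y, hε, hV, hY, rfl⟩ := hr
  obtain ⟨r, hr1, hr2⟩ := exists_between hY
  have hd : ∀ᶠ n in atTop, dist (Y : MeasurableRV X) (s n) < r :=
    ((tendsto_const_nhds (x := (Y : MeasurableRV X))).dist h.tendsto).eventually_lt_const hr1
  have he : ∀ᶠ n : ℕ in atTop, 2 * (2⁻¹ : ℝ) ^ n < ε - r :=
    tendsto_two_mul_inv_two_pow.eventually_lt_const (by linarith)
  filter_upwards [hd, he] with n hn hn'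
  rw [UniformSpace.Completion.dist_eq] at hn
  have hr0 : 0 ≤ r := dist_nonneg.trans hn.le
  have hbad := measure_le_of_fanDist_lt Y (s n) hn
  have hsub : {ω | Y ω ∈ V} ⊆
      {ω | s n ω ∈ innerSet (2 * 2⁻¹ ^ n) U} ∪ {ω | r < dist (Y ω) (s n ω)} := by
    intro ω hω
    by_cases hlt : r < dist (Y ω) (s n ω)
    · exact Or.inr hlt
    · exact Or.inl (innerSet_shrink (by positivity) hr0 (by linarith) (hV hω) (not_lt.1 hlt))
  have := (measureReal_mono (μ := coinMeasure) hsub).trans (measureReal_union_le _ _)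
  have heq : coinMeasure.real {ω | s n ω ∈ innerSet (2 * 2⁻¹ ^ n) U} = innerProb s U n := rfl
  linarith

theorem FastConverges.ofReal_distribution {s : ℕ → ContRV X} {Z : MeasurableRV X}
    (h : FastConverges s Z) (U : TopologicalSpace.Opens X) :
    ENNReal.ofReal (distribution Z U) =
      ⨆ n, ENNReal.ofReal (innerProb s U n - 2 * 2⁻¹ ^ n) := by
  refine le_antisymm ?_ (iSup_le fun n => ENNReal.ofReal_le_ofReal (h.innerProb_sub_le U n))
  set b := ⨆ n, ENNReal.ofReal (innerProb s U n - 2 * 2⁻¹ ^ n) with hb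
  have hle : b ≤ ENNReal.ofReal (distribution Z U) :=
    iSup_le fun n => ENNReal.ofReal_le_ofReal (h.innerProb_sub_le U n)
  refine ENNReal.ofReal_le_of_le_toReal (Real.sSup_le (fun r hr => ?_) ENNReal.toReal_nonneg)
  obtain ⟨n, hn⟩ := (h.eventually_le hr).exists
  rw [← ENNReal.ofReal_le_iff_le_toReal (hle.trans_lt ENNReal.ofReal_lt_top).ne]
  exact (ENNReal.ofReal_le_ofReal hn).trans
    (le_iSup (fun n => ENNReal.ofReal (innerProb s U n - 2 * 2⁻¹ ^ n)) n)

/-! ### Almost sure limits and their laws. -/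

theorem eventually_lt_measureReal {Ω : Type*} [MeasurableSpace Ω] {μ : Measure Ω}
    [IsFiniteMeasure μ] {A : Set Ω} {B : ℕ → Set Ω}
    (h : ∀ᵐ ω ∂μ, ω ∈ A → ∀ᶠ n in atTop, ω ∈ B n) {c : ℝ} (hc : c < μ.real A) :
    ∀ᶠ n in atTop, c < μ.real (B n) := by
  -- The `B n` need not increase, so continuity from below is applied to the events of lying in all
  -- `B n` from `N` on.
  let C : ℕ → Set Ω := fun N => {ω | ∀ n ≥ N, ω ∈ B n}
  have hC : Monotone C := fun M N hMN ω hω n hn => hω n (hMN.trans hn)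
  have hA : μ.real A ≤ μ.real (⋃ N, C N) := by
    refine ENNReal.toReal_mono (measure_ne_top _ _) (measure_mono_ae ?_)
    filter_upwards [h] with ω hω hωA
    obtain ⟨N, hN⟩ := eventually_atTop.1 (hω hωA)
    exact Set.mem_iUnion.2 ⟨N, hN⟩
  have ht : Tendsto (fun N => μ.real (C N)) atTop (𝓝 (μ.real (⋃ N, C N))) :=
    (ENNReal.tendsto_toReal (measure_ne_top _ _)).comp (tendsto_measure_iUnion_atTop hC)
  filter_upwards [ht.eventually_const_lt (hc.trans_le hA)] with n hn
  exact hn.trans_le (measureReal_mono fun ω hω => hω n le_rfl)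

theorem eventually_mem_innerSet {x : ℕ → X} {y : X} (hx : Tendsto x atTop (𝓝 y))
    {U : TopologicalSpace.Opens X} (hy : y ∈ U) :
    ∀ᶠ n in atTop, x n ∈ innerSet (2 * 2⁻¹ ^ n) U := by
  simp only [mem_innerSet]
  have h1 : Tendsto (fun n : ℕ => ENNReal.ofReal (2 * 2⁻¹ ^ n)) atTop (𝓝 0) := by
    simpa using ENNReal.tendsto_ofReal tendsto_two_mul_inv_two_pow
  have h2 : Tendsto (fun n => Metric.infEDist (x n) (U : Set X)ᶜ) atTop
      (𝓝 (Metric.infEDist y (U : Set X)ᶜ)) :=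
    (Metric.continuous_infEDist.tendsto y).comp hx
  refine h1.eventually_lt h2 (Metric.infEDist_pos_iff_notMem_closure.2 ?_)
  rw [U.isOpen.isClosed_compl.closure_eq]
  simpa using hy

/-- Outside the bad event of `hd`, membership of `s n ω` in the inner set forces `T ω ∈ U`, and the
probability of that event is covered by the subtracted 2·2⁻ⁿ. Conversely, if `T ω ∈ U`, convergence
puts `s n ω` eventually into the inner sets, whose margins vanish. -/
theorem FastConverges.distribution_eq {s : ℕ → ContRV X} {Z : MeasurableRV X}
    (h : FastConverges s Z) {T : Cantor → X}
    (hT : ∀ᵐ ω ∂coinMeasure, Tendsto (fun n => s n ω) atTop (𝓝 (T ω)))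
    (hd : ∀ n : ℕ, coinMeasure.real {ω | 2 * (2⁻¹ : ℝ) ^ n < dist (s n ω) (T ω)} ≤ 2 * 2⁻¹ ^ n)
    (U : TopologicalSpace.Opens X) :
    distribution Z U = coinMeasure.real {ω | T ω ∈ U} := by
  refine le_antisymm (Real.sSup_le (fun r hr => ?_) measureReal_nonneg)
    (le_of_forall_lt_imp_le_of_dense fun c hc => ?_)
  · obtain ⟨n, hn⟩ := (h.eventually_le hr).exists
    have hsub : {ω | s n ω ∈ innerSet (2 * 2⁻¹ ^ n) U} ⊆
        {ω | T ω ∈ U} ∪ {ω | 2 * (2⁻¹ : ℝ) ^ n < dist (s n ω) (T ω)} := by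
      intro ω hω
      by_cases hlt : 2 * (2⁻¹ : ℝ) ^ n < dist (s n ω) (T ω)
      · exact Or.inr hlt
      · exact Or.inl (mem_of_mem_innerSet (by positivity) hω (not_lt.1 hlt))
    have := (measureReal_mono (μ := coinMeasure) hsub).trans (measureReal_union_le _ _)
    have heq : coinMeasure.real {ω | s n ω ∈ innerSet (2 * 2⁻¹ ^ n) U} = innerProb s U n := rfl
    linarith [hd n]
  · have hev : ∀ᶠ n in atTop, c < innerProb s U n :=
      eventually_lt_measureReal (hT.mono fun ω hω => eventually_mem_innerSet hω) hc
    have hlim : Tendsto (fun n : ℕ => c - 2 * (2⁻¹ : ℝ) ^ n) atTop (𝓝 c) := by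
      simpa using tendsto_const_nhds.sub tendsto_two_mul_inv_two_pow
    refine le_of_tendsto hlim (hev.mono fun n hn => ?_)
    linarith [h.innerProb_sub_le U n]

theorem distribution_coe (Y : ContRV X) (U : TopologicalSpace.Opens X) :
    distribution (Y : MeasurableRV X) U = coinMeasure.real {ω | Y ω ∈ U} := by
  have hs : FastConverges (fun _ => Y) (Y : MeasurableRV X) :=
    ⟨fun m n => by rw [dist_self]; positivity, tendsto_const_nhds⟩
  refine hs.distribution_eq (ae_of_all _ fun ω => tendsto_const_nhds) (fun n => ?_) U
  have hpos : (0 : ℝ) ≤ 2 * 2⁻¹ ^ n := by positivity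
  simp only [dist_self, hpos.not_gt]
  simp

/-- Consecutive terms differ by more than 2⁻ⁿ with probability at most 2⁻ⁿ. Summability gives almost
sure convergence by Borel–Cantelli, and the geometric tail gives both occurrences of 2·2⁻ⁿ. -/
theorem FastConverges.exists_limit [CompleteSpace X] {s : ℕ → ContRV X} {Z : MeasurableRV X}
    (h : FastConverges s Z) : ∃ T : Cantor → X,
      (∀ᵐ ω ∂coinMeasure, Tendsto (fun n => s n ω) atTop (𝓝 (T ω))) ∧
      ∀ n : ℕ, coinMeasure.real {ω | 2 * (2⁻¹ : ℝ) ^ n < dist (s n ω) (T ω)} ≤ 2 * 2⁻¹ ^ n := by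
  classical
  let B : ℕ → Set Cantor := fun n => {ω | (2⁻¹ : ℝ) ^ n < dist (s n ω) (s (n + 1) ω)}
  have hB : ∀ n, coinMeasure (B n) ≤ 2⁻¹ ^ n := by
    intro n
    have h1 : fanDist (s n) (s (n + 1)) < 2⁻¹ ^ n :=
      (h.dist_lt n (n + 1)).trans_eq (by simp)
    have h2 := ENNReal.ofReal_le_ofReal (measure_le_of_fanDist_lt _ _ h1)
    rw [ofReal_measureReal, ENNReal.ofReal_pow (by norm_num),
      ENNReal.ofReal_inv_of_pos (by norm_num), ENNReal.ofReal_ofNat] at h2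
    exact h2
  have hsum : ∀ n, ∑' k, coinMeasure (B (n + k)) ≤ 2 * 2⁻¹ ^ n := by
    intro n
    refine (ENNReal.tsum_le_tsum fun k => hB (n + k)).trans ?_
    simp only [pow_add]
    rw [ENNReal.tsum_mul_left, ENNReal.tsum_geometric, ENNReal.one_sub_inv_two, inv_inv, mul_comm]
  let T : Cantor → X := fun ω =>
    if hω : ∃ x, Tendsto (fun n => s n ω) atTop (𝓝 x) then hω.choose else s 0 ω
  have hgood : ∀ n ω, (∀ k, ω ∉ B (n + k)) →
      Tendsto (fun n => s n ω) atTop (𝓝 (T ω)) ∧ dist (s n ω) (T ω) ≤ 2 * 2⁻¹ ^ n := by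
    intro n ω hω
    have hgeo : ∀ k, dist (s (n + k) ω) (s (n + (k + 1)) ω) ≤ 2 * 2⁻¹ ^ n / 2 / 2 ^ k := by
      intro k
      refine (not_lt.1 (hω k)).trans_eq ?_
      rw [pow_add, inv_pow, inv_pow]
      field_simp
    have hcau : CauchySeq fun k => s (n + k) ω := cauchySeq_of_le_geometric_two hgeo
    obtain ⟨x, hx⟩ := cauchySeq_tendsto_of_complete hcau
    have hx' : Tendsto (fun n => s n ω) atTop (𝓝 x) := by
      refine (tendsto_add_atTop_iff_nat n).1 ?_
      simpa only [add_comm] using hx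
    have hex : ∃ x, Tendsto (fun n => s n ω) atTop (𝓝 x) := ⟨x, hx'⟩
    have hT : Tendsto (fun n => s n ω) atTop (𝓝 (T ω)) := by
      simp only [T, dif_pos hex]
      exact hex.choose_spec
    rw [tendsto_nhds_unique hx' hT] at hx
    refine ⟨hT, ?_⟩
    simpa using dist_le_of_le_geometric_two_of_tendsto hgeo hx 0
  refine ⟨T, ?_, fun n => ?_⟩
  · have hne : ∑' k, coinMeasure (B k) ≠ ∞ := by
      have := hsum 0
      simp only [zero_add, pow_zero, mul_one] at this
      exact (this.trans_lt ENNReal.ofNat_lt_top).ne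
    filter_upwards [ae_eventually_notMem hne] with ω hω
    obtain ⟨N, hN⟩ := eventually_atTop.1 hω
    exact (hgood N ω fun k => hN _ (Nat.le_add_right N k)).1
  · have hsub : {ω | 2 * (2⁻¹ : ℝ) ^ n < dist (s n ω) (T ω)} ⊆ ⋃ k, B (n + k) := by
      intro ω hω
      by_contra hn
      simp only [Set.mem_iUnion, not_exists] at hn
      exact (hgood n ω hn).2.not_gt hω
    have hle := (measure_mono hsub).trans ((measure_iUnion_le _).trans (hsum n))
    refine (ENNReal.toReal_mono (by finiteness) hle).trans_eq ?_
    simp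

/-! ### Distributions are valuations -/

theorem ContRV.measurable [MeasurableSpace X] [BorelSpace X] (Y : ContRV X) :
    Measurable fun ω => Y ω :=
  (ContinuousMap.continuous (Y : C(Cantor, X))).measurable

theorem isValuation_measure [MeasurableSpace X] [BorelSpace X] [ProperSpace X] (μ : Measure X)
    [IsFiniteMeasure μ] : IsValuation fun U : TopologicalSpace.Opens X => μ (U : Set X) where
  continuous := by
    intro D hne hD V hV
    have hcoe : (V : Set X) = ⋃ U : D, ((U : TopologicalSpace.Opens X) : Set X) := by
      rw [← hV.sSup_eq, sSup_eq_iSup', TopologicalSpace.Opens.coe_iSup]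
    refine ⟨?_, fun b hb => ?_⟩
    · rintro _ ⟨U, hU, rfl⟩
      exact measure_mono (hV.1 hU)
    · change μ (V : Set X) ≤ b
      -- Directed families may be uncountable; a compact subset of the union lies in a single
      -- member, so inner regularity replaces countable continuity.
      rw [V.isOpen.measure_eq_iSup_isCompact μ]
      refine iSup_le fun K => iSup_le fun hKV => iSup_le fun hK => ?_
      have : Nonempty D := hne.to_subtype
      obtain ⟨U, hU⟩ := hK.elim_directed_cover
        (fun U : D => ((U : TopologicalSpace.Opens X) : Set X))
        (fun U => (U : TopologicalSpace.Opens X).isOpen) (hKV.trans hcoe.subset)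
        hD.directed_val
      exact (measure_mono hU).trans (hb ⟨U, U.2, rfl⟩)
  empty := by simp
  modular U V := by
    simpa using (measure_union_add_inter (U : Set X) V.isOpen.measurableSet).symm

theorem isValuation_distribution [ProperSpace X] (Z : MeasurableRV X) :
    IsValuation fun U => ENNReal.ofReal (distribution Z U) := by
  borelize X
  obtain ⟨s, hs⟩ := exists_fastConverges Z
  obtain ⟨T, hT, hd⟩ := hs.exists_limit
  have hmeas : AEMeasurable T coinMeasure :=
    aemeasurable_of_tendsto_metrizable_ae atTop (fun n => (s n).measurable.aemeasurable) hT
  have heq : (fun U => ENNReal.ofReal (distribution Z U)) =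
      fun U : TopologicalSpace.Opens X => coinMeasure.map T (U : Set X) := by
    ext U
    rw [hs.distribution_eq hT hd, ofReal_measureReal,
      Measure.map_apply_of_aemeasurable hmeas U.isOpen.measurableSet]
    rfl
  rw [heq]
  exact isValuation_measure _

end Distribution

/-! ### Computable metric spaces are proper -/

section Proper

/-- Finite use: an output symbol depends only on the prefix read before it was produced. -/
theorem Transforms.eq_of_seqPrefix_eq {α p p' q q' : ℕ → ℕ} {m k : ℕ}
    (hk : tableAnswer α m (seqPrefix p k) = q m + 1)
    (hj : ∀ j < k, tableAnswer α m (seqPrefix p j) = 0) (h' : Transforms α p' q')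
    (hpp' : ∀ i < k, p i = p' i) : q' m = q m := by
  obtain ⟨k', hk', hj'⟩ := h' m
  have hpre : ∀ j ≤ k, seqPrefix p j = seqPrefix p' j := fun j hjk =>
    seqPrefix_congr fun i hi => hpp' i (by omega)
  rcases lt_trichotomy k k' with hlt | rfl | hlt
  · have := hj' k hlt
    rw [← hpre k le_rfl] at this
    omega
  · rw [hpre k le_rfl] at hk
    omega
  · have := hj k' hlt
    rw [hpre k' hlt.le] at this
    omega

theorem exists_seqPrefix_of_isOpen {W : Set (ℕ → ℕ)} (hW : IsOpen W) {p : ℕ → ℕ} (hp : p ∈ W) :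
    ∃ j, ∀ k ≥ j, ∀ p', seqPrefix p' k = seqPrefix p k → p' ∈ W := by
  obtain ⟨I, u, hu, hsub⟩ := isOpen_pi_iff.1 hW p hp
  obtain ⟨B, hB⟩ := I.bddAbove
  refine ⟨B + 1, fun k hk p' hp' => hsub fun i hi => ?_⟩
  have hi' : i < k := by have := hB hi; omega
  have h : (seqPrefix p' k)[i]? = (seqPrefix p k)[i]? := by rw [hp']
  rw [getElem?_seqPrefix, getElem?_seqPrefix, if_pos hi', if_pos hi', Option.some.injEq] at h
  rw [h]
  exact (hu i hi).2

/-- The words all of whose extensions lie in one of the sets `W k` with `k ≤ m` and `I k`. -/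
def UnionAccepts (W : ℕ → Set (ℕ → ℕ)) (I : ℕ → Prop) (m : ℕ) (w : List ℕ) : Prop :=
  ∃ k ≤ m, I k ∧ ∀ p, seqPrefix p w.length = w → p ∈ W k

open scoped Classical in
/-- A table semideciding membership in the union of the open sets `W k` with `I k`. -/
noncomputable def unionTable (W : ℕ → Set (ℕ → ℕ)) (I : ℕ → Prop) (i : ℕ) : ℕ :=
  ((Encodable.decode i : Option (ℕ × List ℕ)).map fun z =>
    if z.2.length < z.1 then 0 else
      1 + if UnionAccepts W I z.1 z.2 then 1 else 0).getD 0

/-- At output position m only the sets `W k` with k ≤ m are consulted, so truncating the union at n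
≥ m leaves the entry unchanged. -/
theorem eventually_unionTable_eq (W : ℕ → Set (ℕ → ℕ)) (i : ℕ) :
    ∀ᶠ n in atTop, unionTable W (· ≤ n) i = unionTable W (fun _ => True) i := by
  rcases hz : (Encodable.decode i : Option (ℕ × List ℕ)) with _ | z
  · simp only [unionTable, hz, Option.map_none, Option.getD_none, eventually_true]
  · filter_upwards [eventually_ge_atTop z.1] with n hn
    have : UnionAccepts W (· ≤ n) z.1 z.2 ↔ UnionAccepts W (fun _ => True) z.1 z.2 :=
      exists_congr fun k => and_congr_right fun hk => and_congr_left fun _ => by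
        simp [hk.trans hn]
    simp only [unionTable, hz, Option.map_some, Option.getD_some]
    by_cases h : UnionAccepts W (fun _ => True) z.1 z.2
    · rw [if_pos h, if_pos (this.2 h)]
    · rw [if_neg h, if_neg (mt this.1 h)]

theorem openNaming_unionTable {X : Type*} [TopologicalSpace X] {δ : Naming X}
    {W : ℕ → Set (ℕ → ℕ)} (hW : ∀ k, IsOpen (W k)) {U : ℕ → TopologicalSpace.Opens X}
    (hWU : ∀ k p x, δ p x → (p ∈ W k ↔ x ∈ U k)) (I : ℕ → Prop) {V : TopologicalSpace.Opens X}
    (hV : ∀ x, x ∈ V ↔ ∃ k, I k ∧ x ∈ U k) : openNaming δ (unionTable W I) V := by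
  classical
  intro p x hpx
  refine ⟨fun m => if UnionAccepts W I m (seqPrefix p m) then 1 else 0, fun m => ⟨m, ?_, fun j hj => ?_⟩, ?_⟩
  · simp [tableAnswer, unionTable, add_comm]
  · simp [tableAnswer, unionTable, hj]
  · change x ∈ V ↔ _
    rw [hV]
    constructor
    · rintro ⟨k, hk, hx⟩
      obtain ⟨j, hj⟩ := exists_seqPrefix_of_isOpen (hW k) ((hWU k p x hpx).2 hx)
      refine ⟨max k j, ?_⟩
      have hex : UnionAccepts W I (max k j) (seqPrefix p (max k j)) :=
        ⟨k, le_max_left _ _, hk, fun p' hp' => hj _ (le_max_right _ _) p' (by simpa using hp')⟩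
      simp only [if_pos hex]
      exact one_ne_zero
    · rintro ⟨m, hm⟩
      by_cases h : UnionAccepts W I m (seqPrefix p m)
      · obtain ⟨k, -, hk, hp⟩ := h
        exact ⟨k, hk, (hWU k p x hpx).1 (hp p (by simp))⟩
      · simp [h] at hm

/-- The name of ∅ is built as the union of the complements of all `A k`. Output exceeding `r` on it
uses finitely many entries, which agree with those of the union truncated at a large n, a name of `A
n`. These names may be noncomputable; realizers must handle them nevertheless. -/
theorem exists_lt_infEDist_of_iUnion_eq_univ {X : Type*} [MetricSpace X] {δ : Naming X}
    (hX : IsComputableMetricSpace δ) {A : ℕ → TopologicalSpace.Closeds X} (hA : Antitone A)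
    (hempty : ⋂ n, (A n : Set X) = ∅) (x : X) {r : ℝ≥0∞} (hr : r < ∞) :
    ∃ n, r < Metric.infEDist x (A n) := by
  choose W hW hWU using fun k => (hX.representation.quotient ((A k).compl : Set X)).1
    (A k).compl.isOpen
  obtain ⟨p, hp⟩ := hX.representation.surjective x
  obtain ⟨α, -, hα⟩ := hX.infDist_computable
  have key : ∀ (I : ℕ → Prop) (C : TopologicalSpace.Closeds X),
      (∀ y, y ∉ C ↔ ∃ k, I k ∧ y ∉ A k) →
      ∃ q, Transforms α (fun i => Nat.pair (p i) (unionTable W I i)) q ∧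
        lowerNaming q (Metric.infEDist x C) := by
    intro I C hC
    refine hα _ (x, C) ⟨by simpa using hp, ?_⟩
    have := openNaming_unionTable (U := fun k => (A k).compl) (V := C.compl) hW hWU I hC
    simpa [closedNaming] using this
  obtain ⟨q, hq, -, hsup⟩ := key (fun _ => True) ⊥ fun y => by
    have hy : y ∉ ⋂ n, (A n : Set X) := by simp [hempty]
    have hbot : y ∉ (⊥ : TopologicalSpace.Closeds X) := fun h => h
    simpa [hbot] using hy
  have hsup' : ⨆ n, ((ratOfCode (q n) : ℝ≥0) : ℝ≥0∞) = ∞ := by simpa using hsup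
  obtain ⟨m, hm⟩ := lt_iSup_iff.1 (hr.trans_eq hsup'.symm)
  obtain ⟨k, hk, hj⟩ := hq m
  have hev : ∀ᶠ n in atTop, ∀ i ∈ Set.Iio k,
      unionTable W (· ≤ n) i = unionTable W (fun _ => True) i :=
    (eventually_all_finite (Set.finite_Iio k)).2 fun i _ => eventually_unionTable_eq W i
  obtain ⟨n, hn⟩ := hev.exists
  obtain ⟨q', hq', -, hsup2⟩ := key (· ≤ n) (A n) fun y =>
    ⟨fun hy => ⟨n, le_rfl, hy⟩, fun ⟨k, hkn, hy⟩ hyn => hy (hA hkn hyn)⟩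
  have heq : q' m = q m :=
    Transforms.eq_of_seqPrefix_eq hk hj hq' fun i hi => by simp only [hn i hi]
  refine ⟨n, hm.trans_le ?_⟩
  rw [← hsup2, ← heq]
  exact le_iSup (fun n => ((ratOfCode (q' n) : ℝ≥0) : ℝ≥0∞)) m

theorem IsComputableMetricSpace.properSpace {X : Type*} [MetricSpace X] {δ : Naming X}
    (hX : IsComputableMetricSpace δ) : ProperSpace X := by
  refine ⟨fun x r => isCompact_iff_isSeqCompact.2 fun y hy => ?_⟩
  by_cases hcl : ∃ a, MapClusterPt a atTop y
  · obtain ⟨a, ha⟩ := hcl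
    obtain ⟨φ, hφ, hlim⟩ := ha.tendsto_subseq
    exact ⟨a, Metric.isClosed_closedBall.mem_of_tendsto hlim (Eventually.of_forall fun n => hy _),
      φ, hφ, hlim⟩
  · exfalso
    -- The intersection of the closures of the tails is the set of cluster points, and each tail
    -- meets the ball.
    let A : ℕ → TopologicalSpace.Closeds X := fun n => ⟨closure (y '' Set.Ici n), isClosed_closure⟩
    have hA : Antitone A := fun m n hmn => closure_mono (Set.image_mono (Set.Ici_subset_Ici.2 hmn))
    have hempty : ⋂ n, (A n : Set X) = ∅ := by
      refine Set.eq_empty_iff_forall_notMem.2 fun a ha => hcl ⟨a, ?_⟩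
      refine mapClusterPt_iff_frequently.2 fun S hS => frequently_atTop.2 fun n => ?_
      obtain ⟨_, hzS, k, hk, rfl⟩ := mem_closure_iff_nhds.1 (Set.mem_iInter.1 ha n) S hS
      exact ⟨k, hk, hzS⟩
    obtain ⟨n, hn⟩ := exists_lt_infEDist_of_iUnion_eq_univ hX hA hempty x
      (ENNReal.ofReal_lt_top (r := r))
    have hmem : y n ∈ (A n : Set X) := subset_closure ⟨n, Set.mem_Ici.2 le_rfl, rfl⟩
    refine hn.not_ge ((Metric.infEDist_le_edist_of_mem hmem).trans ?_)
    rw [edist_dist]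
    refine ENNReal.ofReal_le_ofReal ?_
    simpa [dist_comm] using hy n

end Proper

/-! ### Correctness of the lower bounds -/

theorem foldl_max_range_le_iff (f : ℕ → ℕ) (t b : ℕ) :
    (List.range t).foldl (fun m c => max m (f c)) 0 ≤ b ↔ ∀ c < t, f c ≤ b := by
  induction t with
  | zero => simp
  | succ t ih =>
    rw [Nat.forall_lt_succ_right]
    simp [List.range_succ, ih]

theorem foldl_max_range_eq (f : ℕ → ℕ) (t : ℕ) :
    (List.range t).foldl (fun m c => max m (f c)) 0 = 0 ∨
      ∃ c < t, (List.range t).foldl (fun m c => max m (f c)) 0 = f c := by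
  induction t with
  | zero => simp
  | succ t ih =>
    simp only [List.range_succ, List.foldl_append, List.foldl_cons, List.foldl_nil]
    rcases max_choice ((List.range t).foldl (fun m c => max m (f c)) 0) (f t) with h | h
    · rw [h]
      exact ih.imp_right fun ⟨c, hc, h⟩ => ⟨c, by omega, h⟩
    · exact Or.inr ⟨t, by omega, h⟩

/-- The points of Cantor space accepted at stage `s`. -/
def acceptSet (α p u : ℕ → ℕ) (n s : ℕ) : Set Cantor :=
  {ω | Accepts n (seqPrefix α s) (seqPrefix (fun k => p (Nat.pair n k)) (s.sqrt - n))
    (seqPrefix (cantorName ω) s) (seqPrefix u s)}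

theorem acceptCount_div (α p u : ℕ → ℕ) (n : ℕ) {s t : ℕ} (h : s ≤ t) :
    (acceptCount (seqPrefix α t) (seqPrefix p t) (seqPrefix u t) n s : ℝ) / 2 ^ s =
      coinMeasure.real (acceptSet α p u n s) := by
  classical
  rw [acceptSet, coinMeasure_seqPrefix (fun b => Accepts n (seqPrefix α s)
    (seqPrefix (fun k => p (Nat.pair n k)) (s.sqrt - n)) b (seqPrefix u s))]
  simp only [acceptCount, take_seqPrefix _ h, columnWord_seqPrefix p h]

theorem acceptCount_seqPrefix_congr (α p u : ℕ → ℕ) (n : ℕ) {s t t' : ℕ} (h : s ≤ t)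
    (h' : s ≤ t') : acceptCount (seqPrefix α t) (seqPrefix p t) (seqPrefix u t) n s =
      acceptCount (seqPrefix α t') (seqPrefix p t') (seqPrefix u t') n s := by
  -- Both counts divided by 2^s are the measure of the same event.
  have heq := (acceptCount_div α p u n h).trans (acceptCount_div α p u n h').symm
  rw [div_left_inj' (by positivity)] at heq
  exact_mod_cast heq

/-- The numerators of the lower bounds. -/
noncomputable def lowerSeq (α p u : ℕ → ℕ) (t : ℕ) : ℕ :=
  lowerNum (seqPrefix α t) (seqPrefix p t) (seqPrefix u t) t

/-- Every pair examined at stage t is examined again at t + 1 with doubled numerator, so the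
fractions over 2^t increase. -/
theorem two_mul_lowerSeq_le (α p u : ℕ → ℕ) (t : ℕ) :
    2 * lowerSeq α p u t ≤ lowerSeq α p u (t + 1) := by
  have h1 := (foldl_max_range_le_iff _ (t + 1) _).1 (le_refl (lowerSeq α p u (t + 1)))
  have h2 : lowerSeq α p u t ≤ lowerSeq α p u (t + 1) / 2 := by
    refine (foldl_max_range_le_iff _ t _).2 fun c hc => ?_
    have hs : c.unpair.1 ≤ t := (Nat.unpair_left_le c).trans hc.le
    have h3 := h1 c (by omega)
    rw [acceptCount_seqPrefix_congr α p u _ (hs.trans (Nat.le_succ t)) hs,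
      Nat.succ_sub hs, pow_succ] at h3
    rw [Nat.le_div_iff_mul_le two_pos]
    refine le_trans (le_of_eq ?_) h3
    ring
  omega

/-- For n ≤ s the subtracted `2 ^ (s + 1 - n)` is exactly 2·2⁻ⁿ in units of 2⁻ˢ. The pair (s, n) is
first examined at stage `Nat.pair s n + 1`. -/
theorem le_lowerSeq_div (α p u : ℕ → ℕ) {n s : ℕ} (h : n ≤ s) :
    coinMeasure.real (acceptSet α p u n s) - 2 * 2⁻¹ ^ n ≤
      (lowerSeq α p u (Nat.pair s n + 1) : ℝ) / 2 ^ (Nat.pair s n + 1) := by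
  set t := Nat.pair s n + 1 with ht
  have hst : s ≤ t := (Nat.left_le_pair s n).trans (by omega)
  have h1 := (foldl_max_range_le_iff _ t _).1 (le_refl (lowerSeq α p u t)) (Nat.pair s n) (by omega)
  simp only [Nat.unpair_pair] at h1
  rw [← acceptCount_div α p u n hst]
  set N := acceptCount (seqPrefix α t) (seqPrefix p t) (seqPrefix u t) n s
  have h2 : (2 : ℝ) ^ (t - s) * ((N : ℝ) - 2 ^ (s + 1 - n)) ≤ lowerSeq α p u t := by
    have h3 : ((2 ^ (t - s) * (N - 2 ^ (s + 1 - n)) : ℕ) : ℝ) ≤ lowerSeq α p u t := by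
      exact_mod_cast h1
    refine le_trans ?_ h3
    push_cast
    gcongr
    have := Nat.cast_le (α := ℝ).2 (le_tsub_add (a := 2 ^ (s + 1 - n)) (b := N))
    push_cast at this
    linarith
  have h4 : (2 : ℝ) ^ t = 2 ^ (t - s) * 2 ^ s := by rw [← pow_add]; congr 1; omega
  have h5 : (2 : ℝ) ^ (s + 1 - n) = 2 * 2⁻¹ ^ n * 2 ^ s := by
    have : (2 : ℝ) ^ (s + 1) = 2 ^ (s + 1 - n) * 2 ^ n := by rw [← pow_add]; congr 1; omega
    rw [inv_pow]
    field_simp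
    rw [← this, pow_succ]; ring
  rw [le_div_iff₀ (by positivity)]
  refine le_trans (le_of_eq ?_) h2
  rw [h4, h5]
  field_simp

/-- No relation between n and s is needed: truncated subtraction in the exponent can only make the
subtracted term larger than 2·2⁻ⁿ·2^s. -/
theorem lowerSeq_div_le (α p u : ℕ → ℕ) (t : ℕ) :
    lowerSeq α p u t = 0 ∨ ∃ n s, (lowerSeq α p u t : ℝ) / 2 ^ t ≤
      coinMeasure.real (acceptSet α p u n s) - 2 * 2⁻¹ ^ n := by
  rcases foldl_max_range_eq (fun c => 2 ^ (t - c.unpair.1) *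
    (acceptCount (seqPrefix α t) (seqPrefix p t) (seqPrefix u t) c.unpair.2 c.unpair.1 -
      2 ^ (c.unpair.1 + 1 - c.unpair.2))) t with h | ⟨c, hc, h⟩
  · exact Or.inl h
  change lowerSeq α p u t = _ at h
  have hst : c.unpair.1 ≤ t := (Nat.unpair_left_le c).trans hc.le
  have hdiv := acceptCount_div α p u c.unpair.2 hst
  generalize c.unpair.1 = s at *
  generalize c.unpair.2 = n at *
  generalize acceptCount (seqPrefix α t) (seqPrefix p t) (seqPrefix u t) n s = N at *
  by_cases hle : N ≤ 2 ^ (s + 1 - n)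
  · left
    rw [h, Nat.sub_eq_zero_of_le hle, mul_zero]
  · right
    refine ⟨n, s, ?_⟩
    rw [← hdiv, h]
    push_cast [Nat.cast_sub (not_le.1 hle).le]
    have h4 : (2 : ℝ) ^ t = 2 ^ (t - s) * 2 ^ s := by rw [← pow_add]; congr 1; omega
    have h5 : 2 * 2⁻¹ ^ n * 2 ^ s ≤ (2 : ℝ) ^ (s + 1 - n) := by
      have : (2 : ℝ) ^ (s + 1) ≤ 2 ^ (s + 1 - n) * 2 ^ n := by
        rw [← pow_add]
        exact pow_le_pow_right₀ one_le_two (by omega)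
      rw [inv_pow]
      field_simp
      rw [pow_succ] at this
      linarith
    rw [h4, mul_div_mul_left _ _ (by positivity), sub_div]
    gcongr
    rwa [le_div_iff₀ (by positivity)]

theorem coe_ratOfCode (y : ℕ) :
    ((ratOfCode y : ℝ≥0) : ℝ≥0∞) = ENNReal.ofReal ((y.unpair.1 : ℝ) / (y.unpair.2 + 1)) := by
  rw [ENNReal.ofReal]
  congr 1
  ext
  rw [Real.coe_toNNReal _ (by positivity)]
  simp [ratOfCode]

theorem lt_ratOfCode_iff (n y : ℕ) : 2 * (y.unpair.2 + 1) < y.unpair.1 * 2 ^ n ↔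
    ENNReal.ofReal (2 * 2⁻¹ ^ n) < ((ratOfCode y : ℝ≥0) : ℝ≥0∞) := by
  rw [coe_ratOfCode, ENNReal.ofReal_lt_ofReal_iff_of_nonneg (by positivity),
    lt_div_iff₀ (by positivity), inv_pow, ← div_eq_mul_inv, div_mul_eq_mul_div,
    div_lt_iff₀ (by positivity)]
  exact_mod_cast Iff.rfl

theorem ratOfCode_lowerSeq (α p u : ℕ → ℕ) (t : ℕ) :
    ratOfCode (Nat.pair (lowerSeq α p u t) (2 ^ t - 1)) = lowerSeq α p u t / 2 ^ t := by
  have : ((2 ^ t - 1 : ℕ) : ℚ≥0) + 1 = 2 ^ t := by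
    have h := Nat.sub_add_cancel (Nat.one_le_two_pow (n := t))
    exact_mod_cast h
  rw [ratOfCode, Nat.unpair_pair, this]

theorem monotone_ratOfCode_lowerSeq (α p u : ℕ → ℕ) :
    Monotone fun t => ratOfCode (Nat.pair (lowerSeq α p u t) (2 ^ t - 1)) := by
  refine monotone_nat_of_le_succ fun t => ?_
  rw [ratOfCode_lowerSeq, ratOfCode_lowerSeq, div_le_div_iff₀ (by positivity) (by positivity),
    pow_succ]
  have h : ((2 * lowerSeq α p u t : ℕ) : ℚ≥0) ≤ lowerSeq α p u (t + 1) := by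
    exact_mod_cast two_mul_lowerSeq_le α p u t
  push_cast at h
  calc (lowerSeq α p u t : ℚ≥0) * (2 ^ t * 2) = 2 * lowerSeq α p u t * 2 ^ t := by ring
    _ ≤ _ := by gcongr

section Accept

variable {X : Type*} [MetricSpace X] {δ : Naming X} {α p u : ℕ → ℕ}
  {U : TopologicalSpace.Opens X} {Y : ContRV X} {n : ℕ}

theorem mem_innerSet_of_mem_acceptSet
    (hα : ∀ x y, δ x y → ∃ r, Transforms α (fun i => Nat.pair (x i) (u i)) r ∧
      lowerNaming r (Metric.infEDist y (U : Set X)ᶜ))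
    (hY : funNaming cantorNaming δ (fun k => p (Nat.pair n k)) Y) {s : ℕ} {ω : Cantor}
    (hω : ω ∈ acceptSet α p u n s) : Y ω ∈ innerSet (2 * 2⁻¹ ^ n) U := by
  obtain ⟨x, hx, hxY⟩ := hY _ _ (cantorNaming_cantorName ω)
  obtain ⟨r, hr, -, hsup⟩ := hα x _ hxY
  obtain ⟨y, hy, hlt⟩ := hω
  rw [evalWord_sound hx, pairWord_seqPrefix, evalWord_sound hr] at hy
  obtain ⟨i, -, rfl⟩ := List.mem_map.1 hy
  rw [mem_innerSet, ← hsup]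
  exact ((lt_ratOfCode_iff _ _).1 hlt).trans_le
    (le_iSup (fun i => ((ratOfCode (r i) : ℝ≥0) : ℝ≥0∞)) i)

theorem tendsto_sqrt_sub_atTop (n : ℕ) : Tendsto (fun s : ℕ => s.sqrt - n) atTop atTop := by
  refine tendsto_atTop.2 fun b => ?_
  filter_upwards [eventually_ge_atTop ((b + n) ^ 2)] with s hs
  have := Nat.le_sqrt'.2 hs
  omega

theorem eventually_mem_acceptSet
    (hα : ∀ x y, δ x y → ∃ r, Transforms α (fun i => Nat.pair (x i) (u i)) r ∧
      lowerNaming r (Metric.infEDist y (U : Set X)ᶜ))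
    (hY : funNaming cantorNaming δ (fun k => p (Nat.pair n k)) Y) {ω : Cantor}
    (hω : Y ω ∈ innerSet (2 * 2⁻¹ ^ n) U) : ∀ᶠ s in atTop, ω ∈ acceptSet α p u n s := by
  obtain ⟨x, hx, hxY⟩ := hY _ _ (cantorNaming_cantorName ω)
  obtain ⟨r, hr, -, hsup⟩ := hα x _ hxY
  rw [mem_innerSet, ← hsup] at hω
  obtain ⟨i, hi⟩ := lt_iSup_iff.1 hω
  obtain ⟨S, hS⟩ := evalWord_complete hr (i + 1)
  obtain ⟨S', hS'⟩ := evalWord_complete hx S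
  -- The associate of `Y` is known only to length `s.sqrt - n`, which still tends to infinity; it
  -- must yield `S` letters of the name of `Y ω` before the distance can be evaluated.
  filter_upwards [(tendsto_sqrt_sub_atTop n).eventually_ge_atTop S', eventually_ge_atTop S,
    eventually_ge_atTop S'] with s h1 h2 h3
  refine ⟨r i, ?_, (lt_ratOfCode_iff _ _).2 hi⟩
  have h4 := hS' _ h1 _ h3
  have h5 := hS s h2 _ (le_min h4 h2)
  rw [evalWord_sound hx, pairWord_seqPrefix, evalWord_sound hr]
  exact List.mem_map.2 ⟨i, List.mem_range.2 (by omega), rfl⟩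

theorem lowerNaming_distribution {Z : MeasurableRV X} {s : ℕ → ContRV X}
    (hα : ∀ x y, δ x y → ∃ r, Transforms α (fun i => Nat.pair (x i) (u i)) r ∧
      lowerNaming r (Metric.infEDist y (U : Set X)ᶜ))
    (hs : seqNaming (funNaming cantorNaming δ) p fun n => ⇑(s n)) (hZ : FastConverges s Z) :
    lowerNaming (fun t => Nat.pair (lowerSeq α p u t) (2 ^ t - 1))
      (ENNReal.ofReal (distribution Z U)) := by
  have hval : ∀ t, ((ratOfCode (Nat.pair (lowerSeq α p u t) (2 ^ t - 1)) : ℝ≥0) : ℝ≥0∞) =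
      ENNReal.ofReal ((lowerSeq α p u t : ℝ) / 2 ^ t) := by
    intro t
    rw [ratOfCode_lowerSeq, ENNReal.ofReal]
    congr 1
    ext
    rw [Real.coe_toNNReal _ (by positivity)]
    simp
  refine ⟨monotone_ratOfCode_lowerSeq α p u, ?_⟩
  simp only [hval, hZ.ofReal_distribution U]
  refine le_antisymm (iSup_le fun t => ?_) (iSup_le fun n => ?_)
  · rcases lowerSeq_div_le α p u t with h | ⟨n, k, h⟩
    · simp [h]
    · refine le_iSup_of_le n (ENNReal.ofReal_le_ofReal (h.trans (sub_le_sub_right ?_ _)))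
      exact measureReal_mono fun ω hω => mem_innerSet_of_mem_acceptSet hα (hs n) hω
  · refine le_of_forall_lt fun c hc => ?_
    have hne : c ≠ ∞ := hc.ne_top
    rw [ENNReal.lt_ofReal_iff_toReal_lt hne] at hc
    have hev : ∀ᶠ k in atTop, c.toReal + 2 * 2⁻¹ ^ n < coinMeasure.real (acceptSet α p u n k) :=
      eventually_lt_measureReal (ae_of_all _ fun ω hω => eventually_mem_acceptSet hα (hs n) hω)
        (lt_sub_iff_add_lt.1 hc)
    -- The stage must also satisfy n ≤ k, so that no rounding is lost in `le_lowerSeq_div`.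
    obtain ⟨k, hk, hnk⟩ := (hev.and (eventually_ge_atTop n)).exists
    refine lt_of_lt_of_le ?_ (le_iSup (fun t =>
      ENNReal.ofReal ((lowerSeq α p u t : ℝ) / 2 ^ t)) (Nat.pair k n + 1))
    rw [ENNReal.lt_ofReal_iff_toReal_lt hne]
    exact (lt_sub_iff_add_lt.2 hk).trans_le (le_lowerSeq_div α p u hnk)

end Accept

theorem mainTheorem1 {X : Type*} [MetricSpace X] (δ : Naming X)
    (hX : IsComputableMetricSpace δ) :
    (∀ Z : MeasurableRV X,
      (∀ U, 0 ≤ distribution Z U ∧ distribution Z U ≤ 1) ∧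
      IsValuation (fun U => ENNReal.ofReal (distribution Z U))) ∧
    IsComputableMap (rvNaming δ) (funNaming (openNaming δ) lowerNaming)
      (fun Z U => ENNReal.ofReal (distribution Z U)) ∧
    (∀ (Y : ContRV X) (U : TopologicalSpace.Opens X),
      distribution (Y : MeasurableRV X) U = coinMeasure.real {ω | Y ω ∈ U}) := by
  have : ProperSpace X := hX.properSpace
  refine ⟨fun Z => ⟨fun U => ⟨distribution_nonneg Z U, distribution_le_one Z U⟩,
    isValuation_distribution Z⟩, ?_, distribution_coe⟩
  obtain ⟨α, hcomp, hα⟩ := hX.infDist_computable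
  refine ⟨distributionTable α, computable_distributionTable hcomp, ?_⟩
  rintro p Z ⟨s, hs, hdist, hlim⟩
  obtain ⟨q, hq, hqu⟩ := transforms_distributionTable α p
  refine ⟨q, hq, fun u U hu => ⟨_, hqu u, ?_⟩⟩
  refine lowerNaming_distribution (fun x y hxy => ?_) hs ⟨hdist, hlim⟩
  -- A name of the open set `U` is literally a name of its closed complement.
  have hUU : U.compl.compl = U := TopologicalSpace.Opens.ext (compl_compl _)
  have := hα (fun i => Nat.pair (x i) (u i)) (y, U.compl)
    ⟨by simpa using hxy, by simpa [closedNaming, hUU] using hu⟩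
  simpa using this
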